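/- All graphs are finite and simple; $v(G)$ denotes the number of vertices of $G$. Write $G\to(F,H)$ if every red-blue colouring of the edges of $G$ contains a red copy of $F$ or a blue copy of $H$ (as a not necessarily induced subgraph), and let $R(F,H)=\min\{r: K_r\to(F,H)\}$. With $r=R(F,H)$, the star-critical Ramsey number $R_{\mathbb S}(F,H)$ is the largest $k\ge 1$ such that $K_r\setminus K_{1,k}\to(F,H)$, where $K_r\setminus K_{1,k}$ is $K_r$ with the edges of a star $K_{1,k}$ deleted; it is $0$ if there is no such $k$. For a graph $F$ with chromatic number $\chi(F)\ge 2$, let $s(F)$ be the smallest size of a colour class in a proper colouring of $F$ with $\chi(F)$ colours, and let $\tau(F)$ be the minimum, over all proper colourings of $F$ with $\chi(F)$ colours, all colour classes $U$ of size $s(F)$, all vertices $x\in U$ and all colour classes $U'\ne U$, of the number of neighbours of $x$ in $U'$. **Theorem.** Let $F$ be a graph with $\chi(F)\ge 2$ and let $H$ be a connected graph. There is an integer $N\ge v(H)$, depending only on $F$ and $H$, such that the following holds for every $n\ge N$ and every edge $uv$ of $H$. Let $H_n$ be the graph on $n$ vertices obtained from $H$ by putting $n-v(H)$ extra vertices on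 the edge $uv$, that is, by replacing $uv$ by a path of length $n-v(H)+1$ from $u$ to $v$ with new internal vertices. Then $$R_{\mathbb S}(F,H_n)=n+C_n(F,H)\quad\text{with}\quad |C_n(F,H)|\le v(F)^2+v(H).$$ More precisely, writing $m=v(F)$, $$n-v(H)-(m-2)(m-t)-t-1\;\le\; R_{\mathbb S}(F,H_n)\;\le\; n+s(F)-\tau(F)-2,$$ where $t$ is the size of the largest colour class in any proper colouring of $F$ with $\chi(F)$ colours that has a colour class of size $s(F)$. -/

import Mathlib

/-- `G → (F, H)`: every red-blue colouring of the edges of `G` contains a red copy of `F` or a blue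
copy of `H` (copies are not necessarily induced). A colouring is given by its red graph `R ≤ G`;
the blue graph is then `G \ R`. -/
def RamseyArrows {α V W : Type*} (G : SimpleGraph α) (F : SimpleGraph V) (H : SimpleGraph W) :
    Prop :=
  ∀ R : SimpleGraph α, R ≤ G → F.IsContained R ∨ H.IsContained (G \ R)

/-- The Ramsey number `R(F, H)`: the least `r` with `K_r → (F, H)`. -/
noncomputable def ramseyNumber {V W : Type*} (F : SimpleGraph V) (H : SimpleGraph W) : ℕ :=
  sInf {r : ℕ | RamseyArrows (⊤ : SimpleGraph (Fin r)) F H}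

/-- The star `S_k = K_{1,k}` with `k` edges. -/
def starWithEdges (k : ℕ) : SimpleGraph (Fin 1 ⊕ Fin k) :=
  completeBipartiteGraph (Fin 1) (Fin k)

/-- The star-critical Ramsey number: the largest `k ≥ 1` such that `K_r` with the edges of a star
`S_k` deleted still arrows `(F, H)`, where `r = R(F, H)`; it is `0` if there is no such `k`
(in `ℕ` the supremum of the empty set is `0`). The star is placed in `K_r` by an injection `f`,
so `k ≤ r - 1`, and all placements are equivalent under the symmetries of `K_r`. -/
noncomputable def starCriticalRamsey {V W : Type*} (F : SimpleGraph V) (H : SimpleGraph W) : ℕ :=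
  sSup {k : ℕ | 1 ≤ k ∧ ∃ f : (Fin 1 ⊕ Fin k) ↪ Fin (ramseyNumber F H),
    RamseyArrows ((⊤ : SimpleGraph (Fin (ramseyNumber F H))) \ (starWithEdges k).map f) F H}

/-- The vertices in order, with indices `0, 1, …, k + 1`, of the path with `k` new internal vertices
that replaces the edge `uv`. -/
def subdivisionVertex {W : Type*} (u v : W) (k i : ℕ) : W ⊕ Fin k :=
  if i = 0 then Sum.inl u
  else if h : i - 1 < k then Sum.inr ⟨i - 1, h⟩
  else Sum.inl v

/-- The graph obtained from `H` by putting `k` extra vertices on the edge `uv`: the edge is replaced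
by a path of length `k + 1` from `u` to `v` whose `k` internal vertices are new. -/
def subdivideEdge {W : Type*} (H : SimpleGraph W) (u v : W) (k : ℕ) : SimpleGraph (W ⊕ Fin k) :=
  (H.deleteEdges {s(u, v)}).map Function.Embedding.inl ⊔
    SimpleGraph.fromRel (fun x y => ∃ i ≤ k,
      x = subdivisionVertex u v k i ∧ y = subdivisionVertex u v k (i + 1))

/-- The proper colourings of `F` with exactly `χ(F)` colours (`χ(F)` is finite for finite `F`). -/
abbrev OptimalColoring {V : Type*} (F : SimpleGraph V) : Type _ :=
  F.Coloring (Fin F.chromaticNumber.toNat)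

/-- The chromatic surplus `s(F)`: the smallest size of a colour class in a proper colouring of `F`
with `χ(F)` colours. -/
noncomputable def chromaticSurplus {V : Type*} (F : SimpleGraph V) : ℕ :=
  sInf {c : ℕ | ∃ (C : OptimalColoring F) (i : Fin F.chromaticNumber.toNat),
    c = (C.colorClass i).ncard}

/-- `τ(F)`: the least number of neighbours that a vertex of `U₁` has in another class `U_j`, over
all proper colourings of `F` with `χ(F)` colours and all colour classes `U₁` of size `s(F)`. -/
noncomputable def surplusMinDegree {V : Type*} (F : SimpleGraph V) : ℕ :=
  sInf {d : ℕ | ∃ (C : OptimalColoring F) (i j : Fin F.chromaticNumber.toNat) (x : V),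
    (C.colorClass i).ncard = chromaticSurplus F ∧ i ≠ j ∧ x ∈ C.colorClass i ∧
    d = (F.neighborSet x ∩ C.colorClass j).ncard}

/-- The size of a largest colour class of a colouring. -/
noncomputable def largestClass {V : Type*} {F : SimpleGraph V} (C : OptimalColoring F) : ℕ :=
  Finset.univ.sup fun i => (C.colorClass i).ncard

/-! Put m = v(F), q = χ(F) and r = (q - 1)(n - 1) + s(F). The proof shows R(F, H_n) = r and compares
two arguments on r vertices.

Arrowing: let every pair be coloured except at most κ pairs at one vertex w. The classes of an
optimal colouring of F are embedded one at a time as a red complete multipartite graph, starting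
with a class of size s(F). For each further class, Ramsey's theorem gives a red K_m, which finishes,
or a large blue clique, hence a blue copy of H with a path in place of uv; lengthen that path while
possible. If H_n is not reached, the copy has at most n - 1 vertices, and induction places the
earlier classes outside it. The successors on the path of the blue neighbours of an outside vertex
are pairwise red (`SubdividedCopy.extend_or_successors_nonadjacent`), so there are at most m - 2
such neighbours, or m - 1 for w. Hence the path has room for the next class in the common red
neighbourhood (`multipartiteCopy_insert_or_subdividedCopy`). The extra loss 1 + κ at w is what
limits κ; κ = 0 gives R(F, H_n) ≤ r.

Not arrowing: colour edges red between q classes and blue inside them, with one class of at most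
s(F) vertices and the others of at most n - 1. Blue components are too small for the connected graph
H_n. A red F needs s(F) vertices in the small class, so it fails below r vertices
(`not_arrows_top`). On r vertices it must use w, placed in the small class, and w has too few red
neighbours in some other class (`not_arrows_of_missing`). -/

/-! ### Ramsey's theorem for two colours. -/

/-- Every pair of distinct vertices of `X` is joined by an edge of `R` or of `B`. -/
def EdgesCover {α : Type} (R B : SimpleGraph α) (X : Finset α) : Prop :=
  ∀ x ∈ X, ∀ y ∈ X, x ≠ y → R.Adj x y ∨ B.Adj x y

/-- Ramsey's theorem for two colours. -/
theorem exists_clique_or_clique (a b : ℕ) : ∃ N : ℕ, ∀ (α : Type) (R B : SimpleGraph α)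
    (X : Finset α), EdgesCover R B X → N ≤ X.card →
      (∃ T ⊆ X, T.card = a ∧ ∀ x ∈ T, ∀ y ∈ T, x ≠ y → R.Adj x y) ∨
      (∃ T ⊆ X, T.card = b ∧ ∀ x ∈ T, ∀ y ∈ T, x ≠ y → B.Adj x y) := by
  induction a generalizing b with
  | zero => exact ⟨0, fun α R B X _ _ => Or.inl ⟨∅, by simp, rfl, by simp⟩⟩
  | succ a iha =>
    induction b with
    | zero => exact ⟨0, fun α R B X _ _ => Or.inr ⟨∅, by simp, rfl, by simp⟩⟩
    | succ b ihb =>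
      obtain ⟨N₁, h₁⟩ := iha (b + 1)
      obtain ⟨N₂, h₂⟩ := ihb
      refine ⟨N₁ + N₂ + 1, fun α R B X hX hN => ?_⟩
      classical
      obtain ⟨x, hx⟩ : X.Nonempty := Finset.card_pos.mp (by omega)
      have hsub : X.erase x ⊆ X := Finset.erase_subset _ _
      have hcov : ∀ Y ⊆ X.erase x, EdgesCover R B Y := fun Y hY y hy z hz =>
        hX y (hsub (hY hy)) z (hsub (hY hz))
      have key : ∀ (Q : SimpleGraph α) (T : Finset α), T ⊆ X.erase x → (∀ y ∈ T, Q.Adj x y) →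
          (∀ y ∈ T, ∀ z ∈ T, y ≠ z → Q.Adj y z) →
          insert x T ⊆ X ∧ (insert x T).card = T.card + 1 ∧
            ∀ y ∈ insert x T, ∀ z ∈ insert x T, y ≠ z → Q.Adj y z := by
        intro Q T hT hQ hc
        have hxT : x ∉ T := fun h => by simpa using hT h
        refine ⟨Finset.insert_subset hx (hT.trans hsub), Finset.card_insert_of_notMem hxT, ?_⟩
        intro y hy z hz hyz
        rcases Finset.mem_insert.mp hy with hy' | hy' <;>
          rcases Finset.mem_insert.mp hz with hz' | hz'
        · exact absurd (hy'.trans hz'.symm) hyz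
        · rw [hy']; exact hQ z hz'
        · rw [hz']; exact (hQ y hy').symm
        · exact hc y hy' z hz' hyz
      set Y := (X.erase x).filter (R.Adj x) with hY
      have hYs : Y ⊆ X.erase x := Finset.filter_subset _ _
      have hcard : Y.card + (X.erase x \ Y).card = X.card - 1 := by
        rw [← Finset.card_erase_of_mem hx, add_comm, Finset.card_sdiff_add_card_eq_card hYs]
      by_cases hN1 : N₁ ≤ Y.card
      · rcases h₁ α R B _ (hcov _ hYs) hN1 with ⟨T, hT, hTc, hTa⟩ | ⟨T, hT, h⟩
        · obtain ⟨k1, k2, k3⟩ := key R T (hT.trans hYs)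
            (fun y hy => (Finset.mem_filter.mp (hT hy)).2) hTa
          exact Or.inl ⟨_, k1, by rw [k2, hTc], k3⟩
        · exact Or.inr ⟨T, hT.trans (hYs.trans hsub), h⟩
      · have hZs : X.erase x \ Y ⊆ X.erase x := Finset.sdiff_subset
        rcases h₂ α R B _ (hcov _ hZs) (by omega) with ⟨T, hT, h⟩ | ⟨T, hT, hTc, hTa⟩
        · exact Or.inl ⟨T, hT.trans (hZs.trans hsub), h⟩
        · obtain ⟨k1, k2, k3⟩ := key B T (hT.trans hZs) (fun y hy => by
            have h := Finset.mem_sdiff.mp (hT hy)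
            have h' := Finset.mem_erase.mp h.1
            exact (hX x hx y h'.2 h'.1.symm).resolve_left
              fun hR => h.2 (Finset.mem_filter.mpr ⟨h.1, hR⟩)) hTa
          exact Or.inr ⟨_, k1, by rw [k2, hTc], k3⟩

/-! ### Copies of subdivided graphs and the lengthening of their paths. -/

/-- A copy in `B` of `H` with `k` extra vertices on the edge `uv`: the vertices of `H` are placed
by `g`, and the path replacing `uv` is `p 0, …, p (k + 1)`. -/
structure SubdividedCopy {α W : Type*} (B : SimpleGraph α) (H : SimpleGraph W) (u v : W) (k : ℕ)
    (g : W → α) (p : ℕ → α) : Prop where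
  inj : Function.Injective g
  adj : ∀ x y, H.Adj x y → s(x, y) ≠ s(u, v) → B.Adj (g x) (g y)
  start : p 0 = g u
  finish : p (k + 1) = g v
  path : ∀ i ≤ k, B.Adj (p i) (p (i + 1))
  avoid : ∀ i, 1 ≤ i → i ≤ k → ∀ x, g x ≠ p i
  pathInj : ∀ i j, 1 ≤ i → i ≤ k → 1 ≤ j → j ≤ k → p i = p j → i = j

namespace SubdividedCopy

variable {α W : Type*} {B : SimpleGraph α} {H : SimpleGraph W} {u v : W} {k : ℕ}
  {g : W → α} {p : ℕ → α}

/-- The fields separate internal vertices from each other and from the image of `g`; the two ends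
are told apart by `u ≠ v`. -/
theorem injOn (h : SubdividedCopy B H u v k g p) (huv : u ≠ v) {i j : ℕ} (hi : i ≤ k + 1)
    (hj : j ≤ k + 1) (hij : p i = p j) : i = j := by
  by_contra hne
  wlog hlt : i < j generalizing i j
  · exact this hj hi hij.symm (Ne.symm hne) (by omega)
  by_cases h0 : i = 0
  · subst h0
    by_cases hjk : j = k + 1
    · subst hjk
      rw [h.start, h.finish] at hij
      exact huv (h.inj hij)
    · exact h.avoid j (by omega) (by omega) u (by rw [← h.start, hij])
  · by_cases hjk : j = k + 1
    · subst hjk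
      exact h.avoid i (by omega) (by omega) v (by rw [← h.finish, hij])
    · exact hne (h.pathInj i j (by omega) (by omega) (by omega) (by omega) hij)

theorem isContained (h : SubdividedCopy B H u v k g p) : (subdivideEdge H u v k).IsContained B := by
  let φ : W ⊕ Fin k → α := Sum.elim g (fun i => p (i + 1))
  have hφ : ∀ i ≤ k + 1, φ (subdivisionVertex u v k i) = p i := by
    intro i hi
    unfold subdivisionVertex
    split_ifs with h0 h1
    · subst h0; exact h.start.symm
    · simp only [φ, Sum.elim_inr]
      congr 1; omega
    · have : i = k + 1 := by omega
      subst this; exact h.finish.symm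
  refine ⟨⟨⟨φ, ?_⟩, ?_⟩⟩
  · intro a b hab
    rcases (SimpleGraph.sup_adj _ _ _ _).mp hab with hab | hab
    · obtain ⟨x, y, hxy, rfl, rfl⟩ := (SimpleGraph.map_adj _ _ _ _).mp hab
      rw [SimpleGraph.deleteEdges_adj] at hxy
      exact h.adj x y hxy.1 (by simpa using hxy.2)
    · rw [SimpleGraph.fromRel_adj] at hab
      rcases hab.2 with ⟨i, hi, rfl, rfl⟩ | ⟨i, hi, rfl, rfl⟩
      · rw [hφ i (by omega), hφ (i + 1) (by omega)]; exact h.path i hi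
      · rw [hφ i (by omega), hφ (i + 1) (by omega)]; exact (h.path i hi).symm
  · rintro (a | a) (b | b) hab
    · exact congrArg _ (h.inj hab)
    · exact absurd hab (h.avoid _ (by omega) (by omega) _)
    · exact absurd hab.symm (h.avoid _ (by omega) (by omega) _)
    · have := h.pathInj _ _ (by omega) (by omega) (by omega) (by omega) hab
      exact congrArg _ (Fin.ext (by omega))

/-- An embedding of the vertices into a clique is a copy. -/
theorem of_clique (φ : W ⊕ Fin k ↪ α) (hφ : ∀ a b, a ≠ b → B.Adj (φ a) (φ b)) (huv : u ≠ v) :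
    SubdividedCopy B H u v k (fun x => φ (Sum.inl x)) (fun i => φ (subdivisionVertex u v k i)) where
  inj := φ.injective.comp Sum.inl_injective
  adj x y hxy _ := hφ _ _ (by simpa using hxy.ne)
  start := by simp [subdivisionVertex]
  finish := by simp [subdivisionVertex]
  path i hi := by
    refine hφ _ _ ?_
    unfold subdivisionVertex
    split_ifs <;> simp_all <;> omega
  avoid i h1 h2 x := by
    refine fun h => ?_
    have := φ.injective h
    unfold subdivisionVertex at this
    rw [if_neg (by omega), dif_pos (by omega)] at this
    simp at this
  pathInj i j h1 h2 h3 h4 h := by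
    have := φ.injective h
    unfold subdivisionVertex at this
    rw [if_neg (by omega), dif_pos (by omega), if_neg (by omega), dif_pos (by omega)] at this
    simp at this
    omega

/-- Replace the path of a copy. -/
theorem replacePath {p' : ℕ → α} {y : α} (h : SubdividedCopy B H u v k g p)
    (hyg : ∀ x, g x ≠ y) (h0 : p' 0 = p 0)
    (h1 : p' (k + 2) = p (k + 1)) (hpath : ∀ i ≤ k + 1, B.Adj (p' i) (p' (i + 1)))
    (himg : ∀ l, 1 ≤ l → l ≤ k + 1 → p' l = y ∨ ∃ l', 1 ≤ l' ∧ l' ≤ k ∧ p' l = p l')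
    (hinj : ∀ i j, 1 ≤ i → i ≤ k + 1 → 1 ≤ j → j ≤ k + 1 → p' i = p' j → i = j) :
    SubdividedCopy B H u v (k + 1) g p' where
  inj := h.inj
  adj := h.adj
  start := h0.trans h.start
  finish := h1.trans h.finish
  path := hpath
  avoid l hl hl' x := by
    rcases himg l hl hl' with h' | ⟨l', h2, h3, h'⟩
    · rw [h']; exact hyg x
    · rw [h']; exact h.avoid l' h2 h3 x
  pathInj := hinj

/-- A vertex joined to two consecutive vertices of the path can be inserted between them. -/
theorem insert_between {y : α} (h : SubdividedCopy B H u v k g p) (hyg : ∀ x, g x ≠ y)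
    (hyp : ∀ i, 1 ≤ i → i ≤ k → p i ≠ y) {i : ℕ} (hi : i ≤ k) (hyi : B.Adj y (p i))
    (hyi' : B.Adj y (p (i + 1))) :
    ∃ p', SubdividedCopy B H u v (k + 1) g p' ∧
      ∀ l, 1 ≤ l → l ≤ k + 1 → p' l = y ∨ ∃ l', 1 ≤ l' ∧ l' ≤ k ∧ p' l = p l' := by
  let p' : ℕ → α := fun l => if l ≤ i then p l else if l = i + 1 then y else p (l - 1)
  have e1 : ∀ l, l ≤ i → p' l = p l := fun l hl => if_pos hl
  have e2 : p' (i + 1) = y := by simp [p']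
  have e3 : ∀ l, i + 2 ≤ l → p' l = p (l - 1) := fun l hl => by
    simp only [p']; rw [if_neg (by omega), if_neg (by omega)]
  have himg : ∀ l, 1 ≤ l → l ≤ k + 1 → p' l = y ∨ ∃ l', 1 ≤ l' ∧ l' ≤ k ∧ p' l = p l' := by
    intro l hl hl'
    rcases lt_trichotomy l (i + 1) with hc | rfl | hc
    · exact Or.inr ⟨l, hl, by omega, e1 l (by omega)⟩
    · exact Or.inl e2
    · exact Or.inr ⟨l - 1, by omega, by omega, e3 l (by omega)⟩
  refine ⟨p', h.replacePath hyg (e1 0 (by omega)) (e3 _ (by omega)) ?_ himg ?_, himg⟩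
  · intro l hl
    rcases lt_trichotomy l i with hc | rfl | hc
    · rw [e1 l hc.le, e1 (l + 1) hc]; exact h.path l (by omega)
    · rw [e1 l le_rfl, e2]; exact hyi.symm
    · rcases (show i + 1 = l ∨ i + 2 ≤ l by omega) with rfl | hc
      · rw [e2, e3 _ (by omega)]; exact hyi'
      · rw [e3 l hc, e3 _ (by omega)]
        have := h.path (l - 1) (by omega)
        rwa [show l - 1 + 1 = l + 1 - 1 by omega] at this
  · intro a b ha ha' hb hb' hab
    rcases lt_trichotomy a (i + 1) with hc | rfl | hc <;>
      rcases lt_trichotomy b (i + 1) with hd | rfl | hd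
    · rw [e1 a (by omega), e1 b (by omega)] at hab
      exact h.pathInj a b (by omega) (by omega) (by omega) (by omega) hab
    · rw [e1 a (by omega), e2] at hab
      exact absurd hab (hyp a (by omega) (by omega))
    · rw [e1 a (by omega), e3 b (by omega)] at hab
      have := h.pathInj _ _ (by omega) (by omega) (by omega) (by omega) hab
      omega
    · rw [e1 b (by omega), e2] at hab
      exact absurd hab.symm (hyp b (by omega) (by omega))
    · rfl
    · rw [e3 b (by omega), e2] at hab
      exact absurd hab.symm (hyp _ (by omega) (by omega))
    · rw [e3 a (by omega), e1 b (by omega)] at hab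
      have := h.pathInj _ _ (by omega) (by omega) (by omega) (by omega) hab
      omega
    · rw [e3 a (by omega), e2] at hab
      exact absurd hab (hyp _ (by omega) (by omega))
    · rw [e3 a (by omega), e3 b (by omega)] at hab
      have := h.pathInj _ _ (by omega) (by omega) (by omega) (by omega) hab
      omega

/-- If `y` is joined to `p i` and `p j` and the successors of these are joined, then `y` can be
inserted after reversing the part of the path from `p (i + 1)` to `p j`. -/
theorem insert_reversing {y : α} (h : SubdividedCopy B H u v k g p) (hyg : ∀ x, g x ≠ y)
    (hyp : ∀ i, 1 ≤ i → i ≤ k → p i ≠ y) {i j : ℕ} (hij : i < j) (hj : j ≤ k)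
    (hyi : B.Adj y (p i)) (hyj : B.Adj y (p j)) (hs : B.Adj (p (i + 1)) (p (j + 1))) :
    ∃ p', SubdividedCopy B H u v (k + 1) g p' ∧
      ∀ l, 1 ≤ l → l ≤ k + 1 → p' l = y ∨ ∃ l', 1 ≤ l' ∧ l' ≤ k ∧ p' l = p l' := by
  -- The new path reads p 0, …, p i, y, p j, p (j - 1), …, p (i + 1), p (j + 1), …, p (k + 1). The
  -- value of `σ` at i + 1, the place of y, is never used.
  let σ : ℕ → ℕ := fun l => if l ≤ i then l else if l ≤ j + 1 then j + i + 2 - l else l - 1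
  let p' : ℕ → α := fun l => if l = i + 1 then y else p (σ l)
  have e0 : p' (i + 1) = y := by simp [p']
  have e : ∀ l, l ≠ i + 1 → p' l = p (σ l) := fun l hl => if_neg hl
  have s1 : ∀ l, l ≤ i → σ l = l := fun l hl => if_pos hl
  have s2 : ∀ l, i + 2 ≤ l → l ≤ j + 1 → σ l = j + i + 2 - l := fun l hl hl' => by
    simp only [σ]; rw [if_neg (by omega), if_pos hl']
  have s3 : ∀ l, j + 2 ≤ l → σ l = l - 1 := fun l hl => by
    simp only [σ]; rw [if_neg (by omega), if_neg (by omega)]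
  have sr : ∀ l, l ≠ i + 1 → 1 ≤ l → l ≤ k + 1 → 1 ≤ σ l ∧ σ l ≤ k := by
    intro l h1 h2 h3
    simp only [σ]; split_ifs <;> omega
  have si : ∀ a b, a ≠ i + 1 → b ≠ i + 1 → σ a = σ b → a = b := by
    intro a b ha hb
    simp only [σ]; split_ifs <;> omega
  have himg : ∀ l, 1 ≤ l → l ≤ k + 1 → p' l = y ∨ ∃ l', 1 ≤ l' ∧ l' ≤ k ∧ p' l = p l' := by
    intro l hl hl'
    by_cases hc : l = i + 1
    · rw [hc]; exact Or.inl e0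
    · exact Or.inr ⟨σ l, (sr l hc hl hl').1, (sr l hc hl hl').2, e l hc⟩
  refine ⟨p', h.replacePath hyg ?_ ?_ ?_ himg ?_, himg⟩
  · rw [e 0 (by omega), s1 0 (by omega)]
  · rw [e _ (by omega), s3 _ (by omega)]; rfl
  · intro l hl
    rcases lt_trichotomy l i with hc | rfl | hc
    · rw [e l (by omega), e _ (by omega), s1 l hc.le, s1 (l + 1) hc]; exact h.path l (by omega)
    · rw [e l (by omega), s1 l le_rfl, e0]; exact hyi.symm
    · rcases (show i + 1 = l ∨ i + 2 ≤ l by omega) with rfl | hc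
      · rw [e0, e _ (by omega), s2 _ (by omega) (by omega)]
        rwa [show j + i + 2 - (i + 1 + 1) = j by omega]
      · rw [e l (by omega), e _ (by omega)]
        rcases lt_trichotomy l (j + 1) with hd | rfl | hd
        · rw [s2 l hc (by omega), s2 _ (by omega) (by omega)]
          have := h.path (j + i + 2 - (l + 1)) (by omega)
          rw [show j + i + 2 - (l + 1) + 1 = j + i + 2 - l by omega] at this
          exact this.symm
        · rw [s2 _ hc le_rfl, s3 _ (by omega), show j + i + 2 - (j + 1) = i + 1 by omega]
          exact hs
        · rw [s3 l (by omega), s3 _ (by omega)]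
          have := h.path (l - 1) (by omega)
          rwa [show l - 1 + 1 = l + 1 - 1 by omega] at this
  · intro a b ha ha' hb hb' hab
    by_cases hc : a = i + 1 <;> by_cases hd : b = i + 1
    · omega
    · rw [hc, e0, e b hd] at hab
      exact absurd hab.symm (hyp _ (sr b hd hb hb').1 (sr b hd hb hb').2)
    · rw [hd, e0, e a hc] at hab
      exact absurd hab (hyp _ (sr a hc ha ha').1 (sr a hc ha ha').2)
    · rw [e a hc, e b hd] at hab
      exact si a b hc hd (h.pathInj _ _ (sr a hc ha ha').1 (sr a hc ha ha').2 (sr b hd hb hb').1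
        (sr b hd hb hb').2 hab)

/-- The rotation argument: any forbidden edge among y and the successors of its neighbours allows y
to be absorbed, directly or after a reversal. The clause on `p' l` keeps the longer path inside the
old vertices and y, so that maximality within a vertex set can be contradicted. -/
theorem extend_or_successors_nonadjacent {y : α} (h : SubdividedCopy B H u v k g p)
    (hyg : ∀ x, g x ≠ y) (hyp : ∀ i, 1 ≤ i → i ≤ k → p i ≠ y) (I : Finset ℕ)
    (hI : ∀ i ∈ I, i ≤ k ∧ B.Adj y (p i)) :
    (∃ p', SubdividedCopy B H u v (k + 1) g p' ∧
      ∀ l, 1 ≤ l → l ≤ k + 1 → p' l = y ∨ ∃ l', 1 ≤ l' ∧ l' ≤ k ∧ p' l = p l') ∨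
    ((∀ i ∈ I, ¬ B.Adj y (p (i + 1))) ∧
      ∀ i ∈ I, ∀ j ∈ I, i ≠ j → ¬ B.Adj (p (i + 1)) (p (j + 1))) := by
  by_contra hcon
  rw [not_or] at hcon
  obtain ⟨hno, hcon⟩ := hcon
  refine hcon ⟨fun i hi hadj => hno ?_, fun i hi j hj hne hadj => hno ?_⟩
  · exact h.insert_between hyg hyp (hI i hi).1 (hI i hi).2 hadj
  · rcases lt_or_gt_of_ne hne with hlt | hlt
    · exact h.insert_reversing hyg hyp hlt (hI j hj).1 (hI i hi).2 (hI j hj).2 hadj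
    · exact h.insert_reversing hyg hyp hlt (hI i hi).1 (hI j hj).2 (hI i hi).2 hadj.symm

end SubdividedCopy

/-! ### Building a red multipartite graph or a long blue path, class by class. -/

/-- In `X`, any two distinct vertices other than `w` are joined in `R` or `B`, and `w` fails to be
joined to at most `κ` other vertices. -/
structure EdgesCoverOff {α : Type} (R B : SimpleGraph α) (w : α) (κ : ℕ) (X : Finset α) :
    Prop where
  off : ∀ x ∈ X, ∀ y ∈ X, x ≠ w → y ≠ w → x ≠ y → R.Adj x y ∨ B.Adj x y
  missing : ∀ Z ⊆ X, (∀ z ∈ Z, z ≠ w ∧ ¬ R.Adj w z ∧ ¬ B.Adj w z) → Z.card ≤ κ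

theorem EdgesCoverOff.mono {α : Type} {R B : SimpleGraph α} {w : α} {κ : ℕ} {X Y : Finset α}
    (h : EdgesCoverOff R B w κ X) (hY : Y ⊆ X) : EdgesCoverOff R B w κ Y :=
  ⟨fun x hx y hy => h.off x (hY hx) y (hY hy), fun Z hZ => h.missing Z (hZ.trans hY)⟩

/-- The vertices with colours in `S` can be placed injectively in `X` such that vertices of
different colours are joined in `R`. -/
def MultipartiteCopy {V ι : Type*} {α : Type} (R : SimpleGraph α) (C : V → ι) (S : Finset ι)
    (X : Finset α) : Prop :=
  ∃ f : V → α, (∀ x y, C x ∈ S → C y ∈ S → f x = f y → x = y) ∧ (∀ x, C x ∈ S → f x ∈ X) ∧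
    ∀ x y, C x ∈ S → C y ∈ S → C x ≠ C y → R.Adj (f x) (f y)

section

variable {V ι W : Type*} [Fintype V] {α : Type} {R B : SimpleGraph α}

theorem multipartiteCopy_of_clique (C : V → ι) (S : Finset ι) {X T : Finset α} (hT : T ⊆ X)
    (hcard : Fintype.card V ≤ T.card) (hc : ∀ x ∈ T, ∀ y ∈ T, x ≠ y → R.Adj x y) :
    MultipartiteCopy R C S X := by
  obtain ⟨e⟩ : Nonempty (V ↪ T) := Function.Embedding.nonempty_of_card_le (by simpa using hcard)
  refine ⟨fun x => e x, fun x y _ _ h => e.injective (Subtype.ext h), fun x _ => hT (e x).2,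
    fun x y _ _ hxy => hc _ (e x).2 _ (e y).2 fun h => hxy ?_⟩
  rw [e.injective (Subtype.ext h)]

variable [DecidableEq ι]

/-- Extend a copy by one more colour class. -/
theorem multipartiteCopy_insert {C : V → ι} {S : Finset ι} {j : ι} {f : V → α} {X A : Finset α}
    (hinj : ∀ x y, C x ∈ S → C y ∈ S → f x = f y → x = y) (hX : ∀ x, C x ∈ S → f x ∈ X)
    (hadj : ∀ x y, C x ∈ S → C y ∈ S → C x ≠ C y → R.Adj (f x) (f y)) (hA : A ⊆ X)
    (hcard : (Finset.univ.filter fun x => C x = j).card ≤ A.card)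
    (hR : ∀ a ∈ A, ∀ x, C x ∈ S → R.Adj (f x) a) :
    MultipartiteCopy R C (insert j S) X := by
  obtain ⟨e⟩ : Nonempty ({x // C x = j} ↪ A) := Function.Embedding.nonempty_of_card_le (by
    rw [Fintype.card_coe, Fintype.card_subtype]; exact hcard)
  let F : V → α := fun x => if h : C x = j then e ⟨x, h⟩ else f x
  have F1 : ∀ x (h : C x = j), F x = e ⟨x, h⟩ := fun x h => dif_pos h
  have F2 : ∀ x, C x ≠ j → F x = f x := fun x h => dif_neg h
  have hS : ∀ x, C x ∈ insert j S → C x ≠ j → C x ∈ S := fun x h h' =>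
    (Finset.mem_insert.mp h).resolve_left h'
  refine ⟨F, fun x y hx hy hxy => ?_, fun x hx => ?_, fun x y hx hy hne => ?_⟩
  · by_cases h1 : C x = j <;> by_cases h2 : C y = j
    · rw [F1 x h1, F1 y h2] at hxy
      exact congrArg Subtype.val (e.injective (Subtype.ext hxy))
    · rw [F1 x h1, F2 y h2] at hxy
      -- Old images are red to all of A, and red adjacency is irreflexive, so they avoid A.
      exact absurd hxy.symm (hR _ (e ⟨x, h1⟩).2 y (hS y hy h2)).ne
    · rw [F2 x h1, F1 y h2] at hxy
      exact absurd hxy (hR _ (e ⟨y, h2⟩).2 x (hS x hx h1)).ne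
    · rw [F2 x h1, F2 y h2] at hxy
      exact hinj x y (hS x hx h1) (hS y hy h2) hxy
  · by_cases h1 : C x = j
    · rw [F1 x h1]; exact hA (e ⟨x, h1⟩).2
    · rw [F2 x h1]; exact hX x (hS x hx h1)
  · by_cases h1 : C x = j <;> by_cases h2 : C y = j
    · exact absurd (h1.trans h2.symm) hne
    · rw [F1 x h1, F2 y h2]; exact (hR _ (e ⟨x, h1⟩).2 y (hS y hy h2)).symm
    · rw [F2 x h1, F1 y h2]; exact hR _ (e ⟨y, h2⟩).2 x (hS x hx h1)
    · rw [F2 x h1, F2 y h2]; exact hadj x y (hS x hx h1) (hS y hy h2) hne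

/-- A copy whose vertices lie in `X`. -/
def HasSubdividedCopyIn (B : SimpleGraph α) (H : SimpleGraph W) (u v : W) (k : ℕ)
    (X : Finset α) : Prop :=
  ∃ g p, SubdividedCopy B H u v k g p ∧ (∀ x, g x ∈ X) ∧ ∀ i, 1 ≤ i → i ≤ k → p i ∈ X

/-- Climb from a until the next value fails or b is reached; this local maximality is all that is
needed. -/
theorem exists_maximal_of_le {P : ℕ → Prop} {a b : ℕ} (hab : a ≤ b) (ha : P a) :
    ∃ k, a ≤ k ∧ k ≤ b ∧ P k ∧ (k = b ∨ ¬ P (k + 1)) := by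
  induction b, hab using Nat.le_induction with
  | base => exact ⟨a, le_rfl, le_rfl, ha, Or.inl rfl⟩
  | succ b hab ih =>
    obtain ⟨k, h1, h2, h3, rfl | h4⟩ := ih
    · by_cases h : P (k + 1)
      · exact ⟨k + 1, by omega, le_rfl, h, Or.inl rfl⟩
      · exact ⟨k, h1, by omega, h3, Or.inr h⟩
    · exact ⟨k, h1, by omega, h3, Or.inr h4⟩

theorem hasSubdividedCopyIn_of_clique [Fintype W] (H : SimpleGraph W) {u v : W} (huv : u ≠ v)
    {X T : Finset α} (hT : T ⊆ X) {k : ℕ} (hcard : Fintype.card W + k ≤ T.card)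
    (hc : ∀ x ∈ T, ∀ y ∈ T, x ≠ y → B.Adj x y) : HasSubdividedCopyIn B H u v k X := by
  obtain ⟨e⟩ : Nonempty (W ⊕ Fin k ↪ T) := Function.Embedding.nonempty_of_card_le (by simpa using hcard)
  refine ⟨_, _, SubdividedCopy.of_clique (e.trans (Function.Embedding.subtype _))
    (fun a b hab => hc _ (e a).2 _ (e b).2 fun h => hab (e.injective (Subtype.ext h))) huv,
    fun x => hT (e _).2, fun i _ _ => hT (e _).2⟩

/-- If a copy of `H` with `k` extra vertices cannot be extended by `y`, then `y` has few neighbours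
on the path, or the successors of its neighbours form a large clique of the other colour. -/
theorem card_neighbours_le [Fintype W] {H : SimpleGraph W} {u v : W} (huv : u ≠ v) {k : ℕ}
    {g : W → α} {p : ℕ → α} (h : SubdividedCopy B H u v k g p) {X : Finset α}
    (hg : ∀ x, g x ∈ X) (hp : ∀ i, 1 ≤ i → i ≤ k → p i ∈ X) (hX : EdgesCover R B X) {y : α}
    (hyg : ∀ x, g x ≠ y) (hyp : ∀ i, 1 ≤ i → i ≤ k → p i ≠ y) {m : ℕ} (hm : 2 ≤ m)
    (hno : ¬ ∃ T ⊆ X, T.card = m ∧ ∀ x ∈ T, ∀ y ∈ T, x ≠ y → R.Adj x y)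
    (I : Finset ℕ) (hI : ∀ i ∈ I, i ≤ k ∧ B.Adj y (p i)) :
    (∃ p', SubdividedCopy B H u v (k + 1) g p' ∧
      ∀ l, 1 ≤ l → l ≤ k + 1 → p' l = y ∨ ∃ l', 1 ≤ l' ∧ l' ≤ k ∧ p' l = p l') ∨
    (I.card ≤ m - 1 ∧ (y ∈ X → I.card ≤ m - 2)) := by
  classical
  refine (h.extend_or_successors_nonadjacent hyg hyp I hI).imp_right fun ⟨h1, h2⟩ => ?_
  have hpX : ∀ i ≤ k, p (i + 1) ∈ X := fun i hi => by
    rcases Nat.lt_or_ge i k with hlt | hge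
    · exact hp _ (by omega) (by omega)
    · rw [show i = k by omega, h.finish]; exact hg v
  have hpy : ∀ i ≤ k, p (i + 1) ≠ y := fun i hi => by
    rcases Nat.lt_or_ge i k with hlt | hge
    · exact hyp _ (by omega) (by omega)
    · rw [show i = k by omega, h.finish]; exact hyg v
  have hsucc : ∀ J ⊆ I, (J.image fun i => p (i + 1)).card = J.card := fun J hJ =>
    Finset.card_image_of_injOn fun i hi j hj hij => by
      have := h.injOn huv (Nat.succ_le_succ (hI i (hJ hi)).1) (Nat.succ_le_succ (hI j (hJ hj)).1) hij
      omega
  have hsub : ∀ J ⊆ I, (J.image fun i => p (i + 1)) ⊆ X := fun J hJ x hx => by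
    obtain ⟨i, hi, rfl⟩ := Finset.mem_image.mp hx
    exact hpX i (hI i (hJ hi)).1
  have hred : ∀ J ⊆ I, ∀ x ∈ J.image fun i => p (i + 1), ∀ z ∈ J.image fun i => p (i + 1),
      x ≠ z → R.Adj x z := by
    intro J hJ x hx z hz hxz
    refine (hX x (hsub J hJ hx) z (hsub J hJ hz) hxz).resolve_right ?_
    obtain ⟨i, hi, rfl⟩ := Finset.mem_image.mp hx
    obtain ⟨j, hj, rfl⟩ := Finset.mem_image.mp hz
    exact h2 i (hJ hi) j (hJ hj) fun hij => hxz (by rw [hij])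
  refine ⟨?_, fun hy => ?_⟩
  · by_contra hlt
    obtain ⟨J, hJ, hJc⟩ := Finset.exists_subset_card_eq (show m ≤ I.card by omega)
    exact hno ⟨_, hsub J hJ, by rw [hsucc J hJ, hJc], hred J hJ⟩
  -- When y lies in X it is itself red to the successors, so m - 1 of them already complete a red
  -- K_m.
  · by_contra hlt
    obtain ⟨J, hJ, hJc⟩ := Finset.exists_subset_card_eq (show m - 1 ≤ I.card by omega)
    have hyJ : y ∉ J.image fun i => p (i + 1) := fun hmem => by
      obtain ⟨i, hi, hiy⟩ := Finset.mem_image.mp hmem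
      exact hpy i (hI i (hJ hi)).1 hiy
    have hyR : ∀ x ∈ J.image fun i => p (i + 1), R.Adj y x := fun x hx => by
      refine (hX y hy x (hsub J hJ hx) fun hyx => hyJ (hyx ▸ hx)).resolve_right ?_
      obtain ⟨i, hi, rfl⟩ := Finset.mem_image.mp hx
      exact h1 i (hJ hi)
    refine hno ⟨insert y (J.image fun i => p (i + 1)), Finset.insert_subset hy (hsub J hJ), ?_, ?_⟩
    · rw [Finset.card_insert_of_notMem hyJ, hsucc J hJ, hJc]; omega
    · intro a ha b hb hab
      rcases Finset.mem_insert.mp ha with ha' | ha' <;>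
        rcases Finset.mem_insert.mp hb with hb' | hb'
      · exact absurd (ha'.trans hb'.symm) hab
      · rw [ha']; exact hyR b hb'
      · rw [hb']; exact (hyR a ha').symm
      · exact hred J hJ a ha' b hb' hab

open scoped Classical in
/-- Counting common red neighbours: if each vertex of a copy of the classes in `S` fails to be red
to few vertices of `P`, then a further class can be placed in `P`. -/
theorem multipartiteCopy_insert_of_few_bad {C : V → ι} {S : Finset ι} {j : ι} {f : V → α}
    {X P : Finset α} {d e : ℕ} {w : α}
    (hinj : ∀ x y, C x ∈ S → C y ∈ S → f x = f y → x = y) (hX : ∀ x, C x ∈ S → f x ∈ X)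
    (hadj : ∀ x y, C x ∈ S → C y ∈ S → C x ≠ C y → R.Adj (f x) (f y)) (hP : P ⊆ X)
    (hbad : ∀ x, C x ∈ S → ∀ Q ⊆ P, (∀ a ∈ Q, ¬ R.Adj (f x) a) →
      Q.card ≤ d + if f x = w then e else 0)
    (hcard : d * (Finset.univ.filter fun x => C x ∈ S).card +
      (if ∃ x, C x ∈ S ∧ f x = w then e else 0) +
      (Finset.univ.filter fun x => C x = j).card ≤ P.card) :
    MultipartiteCopy R C (insert j S) X := by
  classical
  set T := Finset.univ.filter fun x => C x ∈ S with hT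
  have hTm : ∀ x, x ∈ T ↔ C x ∈ S := by simp [hT]
  set bad : V → Finset α := fun x => P.filter fun a => ¬ R.Adj (f x) a with hbaddef
  have hb : (T.biUnion bad).card ≤ ∑ x ∈ T, (d + if f x = w then e else 0) :=
    Finset.card_biUnion_le.trans (Finset.sum_le_sum fun x hx =>
      hbad x ((hTm x).mp hx) _ (Finset.filter_subset _ _) fun a ha => (Finset.mem_filter.mp ha).2)
  have hsum : ∑ x ∈ T, (d + if f x = w then e else 0) ≤
      d * T.card + if ∃ x, C x ∈ S ∧ f x = w then e else 0 := by
    rw [Finset.sum_add_distrib, Finset.sum_const, smul_eq_mul, mul_comm]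
    refine Nat.add_le_add_left ?_ _
    split_ifs with hex
    · obtain ⟨x, hx, hxw⟩ := hex
      -- By injectivity at most one placed vertex sits at w, so e is paid only once.
      rw [← Finset.sum_erase_add T _ ((hTm x).mpr hx), if_pos hxw, Finset.sum_eq_zero, zero_add]
      intro y hy
      obtain ⟨h1, h2⟩ := Finset.mem_erase.mp hy
      exact if_neg fun h => h1 (hinj y x ((hTm y).mp h2) hx (h.trans hxw.symm))
    · refine (Finset.sum_eq_zero fun y hy => ?_).le
      exact if_neg fun h => hex ⟨y, (hTm y).mp hy, h⟩
  refine multipartiteCopy_insert (A := P \ T.biUnion bad) hinj hX hadj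
    (Finset.sdiff_subset.trans hP) ?_ ?_
  · have := Finset.le_card_sdiff (T.biUnion bad) P
    omega
  · intro a ha x hx
    obtain ⟨h1, h2⟩ := Finset.mem_sdiff.mp ha
    by_contra hR
    exact h2 (Finset.mem_biUnion.mpr ⟨x, (hTm x).mpr hx, Finset.mem_filter.mpr ⟨h1, hR⟩⟩)

/-- The induction step: one more colour class costs `n - 1` more vertices. -/
theorem multipartiteCopy_insert_or_subdividedCopy [Fintype W] {H : SimpleGraph W} {u v : W}
    (huv : u ≠ v) {C : V → ι} {S : Finset ι} {j : ι} {m n κ L ρ q s : ℕ} (hm : 2 ≤ m)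
    (hV : Fintype.card V ≤ m)
    (hρ : ∀ X : Finset α, EdgesCover R B X → ρ ≤ X.card →
      (∃ T ⊆ X, T.card = m ∧ ∀ x ∈ T, ∀ y ∈ T, x ≠ y → R.Adj x y) ∨
      (∃ T ⊆ X, T.card = L ∧ ∀ x ∈ T, ∀ y ∈ T, x ≠ y → B.Adj x y))
    (hL : Fintype.card W + m * m + m ≤ L) (hLn : L ≤ n) (hρn : ρ + 2 ≤ n)
    (hκ : (m - 2) * (Finset.univ.filter fun x => C x ∈ S).card +
      (Finset.univ.filter fun x => C x = j).card + 1 + κ + Fintype.card W ≤ n) {w : α}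
    (ih : ∀ X : Finset α, q * (n - 1) + s ≤ X.card → EdgesCoverOff R B w κ X →
      MultipartiteCopy R C S X ∨ ∃ g p, SubdividedCopy B H u v (n - Fintype.card W) g p)
    (X : Finset α) (hXc : (q + 1) * (n - 1) + s ≤ X.card) (hX : EdgesCoverOff R B w κ X) :
    MultipartiteCopy R C (insert j S) X ∨
      ∃ g p, SubdividedCopy B H u v (n - Fintype.card W) g p := by
  classical
  by_contra hcon
  rw [not_or] at hcon
  obtain ⟨hnoR, hnoB⟩ := hcon
  -- Without w every pair is coloured, so Ramsey's theorem and the rotation argument apply in X'.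
  set X' := X.erase w with hX'
  have hX's : X' ⊆ X := Finset.erase_subset _ _
  have hcov : EdgesCover R B X' := fun x hx y hy hxy =>
    hX.off x (hX's hx) y (hX's hy) (Finset.ne_of_mem_erase hx) (Finset.ne_of_mem_erase hy) hxy
  have hX'c : X.card ≤ X'.card + 1 := by
    have : X.card - 1 ≤ X'.card := Finset.pred_card_le_card_erase
    omega
  have hmul : (q + 1) * (n - 1) = q * (n - 1) + (n - 1) := by ring
  have hclique : ¬ ∃ T ⊆ X', T.card = m ∧ ∀ x ∈ T, ∀ y ∈ T, x ≠ y → R.Adj x y := by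
    rintro ⟨T, hT, hTc, hTa⟩
    exact hnoR (multipartiteCopy_of_clique C _ (hT.trans hX's) (by omega) hTa)
  obtain ⟨T, hT, hTc, hTa⟩ := (hρ X' hcov (by omega)).resolve_left hclique
  obtain ⟨k, hk1, hk2, ⟨g, p, hc, hg, hp⟩, hk3⟩ :=
    exists_maximal_of_le (P := fun k => HasSubdividedCopyIn B H u v k X')
      (show L - Fintype.card W ≤ n - Fintype.card W by omega)
      (hasSubdividedCopyIn_of_clique H huv hT (by omega) hTa)
  have hkn : k ≠ n - Fintype.card W := fun h => hnoB ⟨g, p, h ▸ hc⟩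
  replace hk3 := hk3.resolve_left hkn
  set Im := Finset.univ.image g ∪ (Finset.Icc 1 k).image p with hIm
  have hImg : ∀ x, g x ∈ Im := fun x =>
    Finset.mem_union_left _ (Finset.mem_image_of_mem g (Finset.mem_univ x))
  have hImp : ∀ i, 1 ≤ i → i ≤ k → p i ∈ Im := fun i h1 h2 =>
    Finset.mem_union_right _ (Finset.mem_image_of_mem p (Finset.mem_Icc.mpr ⟨h1, h2⟩))
  have hImc : Im.card ≤ Fintype.card W + k := by
    refine (Finset.card_union_le _ _).trans (Nat.add_le_add Finset.card_image_le ?_)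
    simpa using Finset.card_image_le (s := Finset.Icc 1 k) (f := p)
  -- If the copy has n - 1 vertices, w may stay in Y, since absorbing w would complete H_n.
  -- Otherwise the copy has at most n - 2 vertices and w can be discarded with it at a total cost of
  -- n - 1; it must be, since maximality holds only inside X'.
  obtain ⟨Y, hYX, hYIm, hYc, hYw⟩ : ∃ Y ⊆ X, Disjoint Y Im ∧ q * (n - 1) + s ≤ Y.card ∧
      (w ∈ Y → k + Fintype.card W + 1 = n) := by
    by_cases hlast : k + Fintype.card W + 1 = n
    · refine ⟨X \ Im, Finset.sdiff_subset, Finset.sdiff_disjoint, ?_, fun _ => hlast⟩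
      have := Finset.le_card_sdiff Im X
      omega
    · refine ⟨X' \ Im, Finset.sdiff_subset.trans hX's, Finset.sdiff_disjoint, ?_, fun hw => ?_⟩
      · have := Finset.le_card_sdiff Im X'
        omega
      · exact absurd (Finset.mem_sdiff.mp hw).1 (Finset.notMem_erase w X)
  obtain ⟨f, hf1, hf2, hf3⟩ := (ih Y hYc (hX.mono hYX)).resolve_right hnoB
  have hpX' : ∀ i ≤ k, p i ∈ X' := fun i hi => by
    rcases Nat.eq_zero_or_pos i with h0 | h0
    · rw [h0, hc.start]; exact hg u
    · exact hp i h0 hi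
  have hpinj : Set.InjOn p (Finset.range (k + 1)) := fun i hi j hj hij =>
    hc.injOn huv (by have := Finset.mem_range.mp hi; omega)
      (by have := Finset.mem_range.mp hj; omega) hij
  -- The last vertex p (k + 1) is left out, so every vertex of P has a successor on the path.
  set P := (Finset.range (k + 1)).image p with hPdef
  have hPc : P.card = k + 1 := by rw [Finset.card_image_of_injOn hpinj, Finset.card_range]
  have hPX' : P ⊆ X' := fun a ha => by
    obtain ⟨i, hi, rfl⟩ := Finset.mem_image.mp ha
    exact hpX' i (by have := Finset.mem_range.mp hi; omega)
  have hPIm : P ⊆ Im := fun a ha => by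
    obtain ⟨i, hi, rfl⟩ := Finset.mem_image.mp ha
    rcases Nat.eq_zero_or_pos i with h0 | h0
    · rw [h0, hc.start]; exact hImg u
    · exact hImp i h0 (by have := Finset.mem_range.mp hi; omega)
  have hblue : ∀ y ∈ Y, ∀ Q ⊆ P, (∀ a ∈ Q, B.Adj y a) →
      Q.card ≤ m - 1 ∧ (y ≠ w → Q.card ≤ m - 2) := by
    intro y hy Q hQ hQB
    have hyIm : y ∉ Im := Finset.disjoint_left.mp hYIm hy
    set I := (Finset.range (k + 1)).filter fun i => p i ∈ Q with hI
    have hQI : Q.card ≤ I.card := by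
      refine (Finset.card_le_card fun a ha => ?_).trans (Finset.card_image_le (s := I) (f := p))
      obtain ⟨i, hi, rfl⟩ := Finset.mem_image.mp (hQ ha)
      exact Finset.mem_image_of_mem p (Finset.mem_filter.mpr ⟨hi, ha⟩)
    have hyg : ∀ x, g x ≠ y := fun x h => hyIm (h ▸ hImg x)
    have hyp : ∀ i, 1 ≤ i → i ≤ k → p i ≠ y := fun i h1 h2 h => hyIm (h ▸ hImp i h1 h2)
    rcases card_neighbours_le huv hc hg hp hcov hyg hyp hm hclique I (fun i hi => by
      obtain ⟨h1, h2⟩ := Finset.mem_filter.mp hi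
      exact ⟨by have := Finset.mem_range.mp h1; omega, hQB _ h2⟩) with ⟨p', hp', himg⟩ | ⟨h1, h2⟩
    · exfalso
      by_cases hyw : y = w
      · have := hYw (hyw ▸ hy)
        rw [show k + 1 = n - Fintype.card W by omega] at hp'
        exact hnoB ⟨g, p', hp'⟩
      · refine hk3 ⟨g, p', hp', hg, fun i hi hi' => ?_⟩
        rcases himg i hi hi' with h | ⟨l, hl, hl', h⟩
        · rw [h]; exact Finset.mem_erase.mpr ⟨hyw, hYX hy⟩
        · rw [h]; exact hp l hl hl'
    · exact ⟨hQI.trans h1, fun hyw => hQI.trans (h2 (Finset.mem_erase.mpr ⟨hyw, hYX hy⟩))⟩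
  -- For w the non-red vertices of P number at most (m - 1) + κ, that is, d + e.
  refine hnoR (multipartiteCopy_insert_of_few_bad (P := P) (d := m - 2) (e := 1 + κ) (w := w) hf1
    (fun x hx => hYX (hf2 x hx)) hf3 (hPX'.trans hX's) ?_ ?_)
  · intro x hx Q hQ hQR
    have hy := hf2 x hx
    by_cases hxw : f x = w
    · rw [if_pos hxw]
      have h1 := (hblue _ hy (Q.filter fun a => B.Adj (f x) a)
        ((Finset.filter_subset _ _).trans hQ) fun a ha => (Finset.mem_filter.mp ha).2).1
      have h2 := hX.missing (Q \ Q.filter fun a => B.Adj (f x) a)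
        (Finset.sdiff_subset.trans (hQ.trans (hPX'.trans hX's))) fun a ha => by
          obtain ⟨h3, h4⟩ := Finset.mem_sdiff.mp ha
          refine ⟨Finset.ne_of_mem_erase (hPX' (hQ h3)), hxw ▸ hQR a h3, fun hB => ?_⟩
          exact h4 (Finset.mem_filter.mpr ⟨h3, hxw.symm ▸ hB⟩)
      have := Finset.card_sdiff_add_card_eq_card (Finset.filter_subset (fun a => B.Adj (f x) a) Q)
      omega
    · rw [if_neg hxw]
      refine (hblue _ hy Q hQ fun a ha => ?_).2 hxw
      refine (hX.off _ (hYX hy) a (hX's (hPX' (hQ ha))) hxw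
        (Finset.ne_of_mem_erase (hPX' (hQ ha))) fun h => ?_).resolve_left (hQR a ha)
      exact Finset.disjoint_left.mp hYIm hy (h ▸ hPIm (hQ ha))
  -- If w is used, then P has n - v(H) vertices and `hκ` is exactly what is needed; otherwise k ≥ L
  -- - v(H) ≥ m² + m suffices.
  · rw [hPc]
    split_ifs with hex
    · obtain ⟨x, hx, hxw⟩ := hex
      have := hYw (hxw ▸ hf2 x hx)
      omega
    · have h1 : (Finset.univ.filter fun x => C x ∈ S).card ≤ m :=
        (Finset.card_le_univ _).trans hV
      have h2 : (Finset.univ.filter fun x => C x = j).card ≤ m :=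
        (Finset.card_le_univ _).trans hV
      have h3 : (m - 2) * (Finset.univ.filter fun x => C x ∈ S).card ≤ m * m :=
        Nat.mul_le_mul (Nat.sub_le _ _) h1
      omega

/-- A dense red-blue graph, complete up to `κ` edges at `w`, contains a red complete multipartite
graph with the given classes, or a blue copy of `H` with a long path in place of `uv`. -/
theorem multipartiteCopy_or_subdividedCopy [Fintype ι] [Fintype W] {H : SimpleGraph W} {u v : W}
    (huv : u ≠ v) (C : V → ι) {i₀ j₁ : ι} (hij : i₀ ≠ j₁) {n κ L ρ t : ℕ}
    (hm : 2 ≤ Fintype.card V)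
    (hρ : ∀ X : Finset α, EdgesCover R B X → ρ ≤ X.card →
      (∃ T ⊆ X, T.card = Fintype.card V ∧ ∀ x ∈ T, ∀ y ∈ T, x ≠ y → R.Adj x y) ∨
      (∃ T ⊆ X, T.card = L ∧ ∀ x ∈ T, ∀ y ∈ T, x ≠ y → B.Adj x y))
    (hL : Fintype.card W + Fintype.card V * Fintype.card V + Fintype.card V ≤ L)
    (hLn : L ≤ n) (hρn : ρ + 2 ≤ n)
    (ht : ∀ j, (Finset.univ.filter fun x => C x = j).card ≤ t)
    (ht₁ : (Finset.univ.filter fun x => C x = j₁).card = t)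
    (hκ : (Fintype.card V - 2) * (Fintype.card V - t) + t + 1 + κ + Fintype.card W ≤ n) (w : α)
    (X : Finset α) (hXc : (Fintype.card ι - 1) * (n - 1) +
      (Finset.univ.filter fun x => C x = i₀).card ≤ X.card)
    (hX : EdgesCoverOff R B w κ X) :
    MultipartiteCopy R C Finset.univ X ∨
      ∃ g p, SubdividedCopy B H u v (n - Fintype.card W) g p := by
  have hS : ∀ S : Finset ι, j₁ ∉ S →
      (Finset.univ.filter fun x => C x ∈ S).card ≤ Fintype.card V - t := by
    intro S hS
    have hd : Disjoint (Finset.univ.filter fun x => C x ∈ S)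
        (Finset.univ.filter fun x => C x = j₁) := by
      rw [Finset.disjoint_filter]
      rintro x - hx rfl
      exact hS hx
    have := Finset.card_le_univ ((Finset.univ.filter fun x => C x ∈ S).disjUnion _ hd)
    rw [Finset.card_disjUnion] at this
    omega
  -- Keeping a largest class j₁ for last leaves at most m - t vertices placed before any step; hence
  -- the term (m - 2)(m - t) + t.
  have hstep : ∀ (S : Finset ι) (j : ι), j₁ ∉ S →
      (Fintype.card V - 2) * (Finset.univ.filter fun x => C x ∈ S).card +
      (Finset.univ.filter fun x => C x = j).card + 1 + κ + Fintype.card W ≤ n := by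
    intro S j hj
    have h1 := Nat.mul_le_mul_left (Fintype.card V - 2) (hS S hj)
    have h2 := ht j
    omega
  have main : ∀ S : Finset ι, i₀ ∉ S → j₁ ∉ S → ∀ X : Finset α, S.card * (n - 1) +
      (Finset.univ.filter fun x => C x = i₀).card ≤ X.card → EdgesCoverOff R B w κ X →
      MultipartiteCopy R C (insert i₀ S) X ∨
        ∃ g p, SubdividedCopy B H u v (n - Fintype.card W) g p := by
    intro S
    induction S using Finset.induction_on with
    | empty =>
      intro _ _ X hXc _
      -- No class is placed yet, so `f` is a dummy; the class i₀ costs only its own size.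
      refine Or.inl (multipartiteCopy_insert (f := fun _ => w) (A := X) ?_ ?_ ?_
        (Finset.Subset.refl X) (by simpa using hXc) ?_) <;> simp
    | insert j S hjS ih =>
      intro h1 h2 X hXc hX
      rw [Finset.insert_comm]
      rw [Finset.card_insert_of_notMem hjS] at hXc
      simp only [Finset.mem_insert, not_or] at h1 h2
      refine multipartiteCopy_insert_or_subdividedCopy huv hm le_rfl hρ hL hLn hρn
        (hstep _ j ?_) (ih h1.2 h2.2) X hXc hX
      simp only [Finset.mem_insert, not_or]
      exact ⟨hij.symm, h2.2⟩
  have huniv : insert j₁ (insert i₀ ((Finset.univ.erase i₀).erase j₁)) = Finset.univ := by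
    ext x; simp only [Finset.mem_insert, Finset.mem_erase, Finset.mem_univ]; tauto
  have hcard : ((Finset.univ.erase i₀).erase j₁).card + 1 = Fintype.card ι - 1 := by
    rw [Finset.card_erase_add_one (Finset.mem_erase.mpr ⟨hij.symm, Finset.mem_univ _⟩),
      Finset.card_erase_of_mem (Finset.mem_univ _), Finset.card_univ]
  rw [← huniv]
  refine multipartiteCopy_insert_or_subdividedCopy huv hm le_rfl hρ hL hLn hρn
    (hstep _ j₁ ?_) (main ((Finset.univ.erase i₀).erase j₁) (by simp) (by simp)) X ?_ hX
  · simp [hij.symm]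
  · rwa [hcard]

end

theorem isContained_of_multipartiteCopy {V ι : Type*} [Fintype ι] {α : Type} {F : SimpleGraph V}
    {R : SimpleGraph α} (C : F.Coloring ι) {X : Finset α}
    (h : MultipartiteCopy R C Finset.univ X) : F.IsContained R := by
  obtain ⟨f, hf1, -, hf3⟩ := h
  exact ⟨⟨⟨f, fun {a b} hab => hf3 a b (Finset.mem_univ _) (Finset.mem_univ _) (C.valid hab)⟩,
    fun a b hab => hf1 a b (Finset.mem_univ _) (Finset.mem_univ _) hab⟩⟩

/-! ### Tools for colourings whose blue components are small. -/

/-- A walk in H survives if each use of uv is replaced by the new path. Connectivity confines a blue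
copy to one class in the extremal colourings. -/
theorem connected_subdivideEdge {W : Type*} {H : SimpleGraph W} (hH : H.Connected) (u v : W)
    (k : ℕ) : (subdivideEdge H u v k).Connected := by
  have hpath : ∀ i ≤ k + 1,
      (subdivideEdge H u v k).Reachable (Sum.inl u) (subdivisionVertex u v k i) := by
    intro i
    induction i with
    | zero => intro _; simp [subdivisionVertex]
    | succ i ih =>
      intro hi
      refine (ih (by omega)).trans ?_
      -- Consecutive vertices coincide only when k = 0 and u = v, which is not excluded here.
      by_cases heq : subdivisionVertex u v k i = subdivisionVertex u v k (i + 1)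
      · rw [heq]
      · refine SimpleGraph.Adj.reachable (Or.inr ?_)
        rw [SimpleGraph.fromRel_adj]
        exact ⟨heq, Or.inl ⟨i, by omega, rfl, rfl⟩⟩
  have huv : (subdivideEdge H u v k).Reachable (Sum.inl u) (Sum.inl v) := by
    simpa [subdivisionVertex] using hpath (k + 1) le_rfl
  have hadj : ∀ x y, H.Adj x y → (subdivideEdge H u v k).Reachable (Sum.inl x) (Sum.inl y) := by
    intro x y hxy
    by_cases he : s(x, y) = s(u, v)
    · rcases Sym2.eq_iff.mp he with ⟨rfl, rfl⟩ | ⟨rfl, rfl⟩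
      · exact huv
      · exact huv.symm
    · refine SimpleGraph.Adj.reachable (Or.inl ?_)
      rw [SimpleGraph.map_adj]
      exact ⟨x, y, by rw [SimpleGraph.deleteEdges_adj]; exact ⟨hxy, by simpa using he⟩, rfl, rfl⟩
  have hwalk : ∀ x y, H.Walk x y →
      (subdivideEdge H u v k).Reachable (Sum.inl x) (Sum.inl y) := by
    intro x y p
    induction p with
    | nil => exact SimpleGraph.Reachable.refl _
    | cons h _ ih => exact (hadj _ _ h).trans ih
  have hall : ∀ z, (subdivideEdge H u v k).Reachable (Sum.inl u) z := by
    rintro (x | i)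
    · obtain ⟨p⟩ := hH.preconnected u x
      exact hwalk u x p
    · have := hpath (i + 1) (by omega)
      simpa [subdivisionVertex] using this
  have : Nonempty (W ⊕ Fin k) := ⟨Sum.inl u⟩
  exact ⟨fun a b => (hall a).symm.trans (hall b)⟩

/-- A connected graph is not contained in a graph whose edges stay within small classes. -/
theorem not_isContained_of_small_classes {W α ι : Type*} [Fintype W] [Fintype α] [DecidableEq ι]
    {H : SimpleGraph W} (hH : H.Connected) {B : SimpleGraph α} {c : α → ι}
    (hB : ∀ x y, B.Adj x y → c x = c y)
    (hc : ∀ i, (Finset.univ.filter fun x => c x = i).card < Fintype.card W) :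
    ¬ H.IsContained B := by
  rintro ⟨φ, hφ⟩
  have hwalk : ∀ x y, H.Walk x y → c (φ x) = c (φ y) := by
    intro x y p
    induction p with
    | nil => rfl
    | cons h _ ih => exact (hB _ _ (φ.map_adj h)).trans ih
  obtain ⟨w⟩ := hH.nonempty
  refine (hc (c (φ w))).not_ge ?_
  rw [← Finset.card_univ]
  refine Finset.card_le_card_of_injOn φ (fun x _ => ?_) hφ.injOn
  obtain ⟨p⟩ := hH.preconnected x w
  simpa using hwalk x w p

/-- Peel off blocks of b vertices greedily, the last ones possibly smaller or empty; only the upper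
bound on the sizes matters. -/
theorem exists_balanced_classes {α : Type*} [DecidableEq α] (q b : ℕ) (X : Finset α)
    (hX : X.card ≤ q * b) :
    ∃ c : α → ℕ, (∀ x ∈ X, c x < q) ∧ ∀ i, (X.filter fun x => c x = i).card ≤ b := by
  induction q generalizing X with
  | zero =>
    have : X = ∅ := Finset.card_eq_zero.mp (by omega)
    subst this
    exact ⟨fun _ => 0, by simp, by simp⟩
  | succ q ih =>
    obtain ⟨A, hA, hAc⟩ := Finset.exists_subset_card_eq (Nat.min_le_right b X.card)
    have hmul : (q + 1) * b = q * b + b := by ring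
    obtain ⟨c, h1, h2⟩ := ih (X \ A) (by
      rw [Finset.card_sdiff_of_subset hA, hAc]
      omega)
    refine ⟨fun x => if x ∈ A then q else c x, fun x hx => ?_, fun i => ?_⟩
    · dsimp only
      split_ifs with h
      · omega
      · exact (h1 x (Finset.mem_sdiff.mpr ⟨hx, h⟩)).trans (Nat.lt_succ_self q)
    · by_cases hi : i = q
      · refine (Finset.card_le_card (t := A) fun x hx => ?_).trans (by omega)
        obtain ⟨hxX, hxi⟩ := Finset.mem_filter.mp hx
        by_contra h
        simp only [if_neg h] at hxi
        have := h1 x (Finset.mem_sdiff.mpr ⟨hxX, h⟩)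
        omega
      · refine (Finset.card_le_card fun x hx => ?_).trans (h2 i)
        obtain ⟨hxX, hxi⟩ := Finset.mem_filter.mp hx
        have h : x ∉ A := fun h => by
          simp only [if_pos h] at hxi
          exact hi hxi.symm
        simp only [if_neg h] at hxi
        exact Finset.mem_filter.mpr ⟨Finset.mem_sdiff.mpr ⟨hxX, h⟩, hxi⟩

/-! ### The invariants s(F) and τ(F). -/

section

variable {V : Type*} [Fintype V] {F : SimpleGraph V}

theorem coe_toNat_chromaticNumber (F : SimpleGraph V) :
    (F.chromaticNumber.toNat : ℕ∞) = F.chromaticNumber :=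
  ENat.natCast_toNat (SimpleGraph.chromaticNumber_ne_top_iff_exists.mpr
    ⟨_, F.colorable_chromaticNumber_of_fintype⟩)

theorem two_le_toNat_chromaticNumber (hF : 2 ≤ F.chromaticNumber) :
    2 ≤ F.chromaticNumber.toNat := by
  rw [← coe_toNat_chromaticNumber F] at hF
  exact_mod_cast hF

theorem toNat_chromaticNumber_le_card (F : SimpleGraph V) :
    F.chromaticNumber.toNat ≤ Fintype.card V := by
  have := F.chromaticNumber_le_card
  rw [← coe_toNat_chromaticNumber F] at this
  exact_mod_cast this

omit [Fintype V] in
theorem chromaticSurplus_le (C : OptimalColoring F) (i : Fin F.chromaticNumber.toNat) :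
    chromaticSurplus F ≤ (C.colorClass i).ncard :=
  Nat.sInf_le ⟨C, i, rfl⟩

theorem exists_ncard_colorClass_eq_chromaticSurplus (hF : 2 ≤ F.chromaticNumber) :
    ∃ (C : OptimalColoring F) (i : Fin F.chromaticNumber.toNat),
      (C.colorClass i).ncard = chromaticSurplus F := by
  obtain ⟨C⟩ := F.colorable_chromaticNumber_of_fintype
  have hq := two_le_toNat_chromaticNumber hF
  obtain ⟨C, i, h⟩ := Nat.sInf_mem (s := {c : ℕ | ∃ (C : OptimalColoring F)
    (i : Fin F.chromaticNumber.toNat), c = (C.colorClass i).ncard}) ⟨_, C, ⟨0, by omega⟩, rfl⟩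
  exact ⟨C, i, h.symm⟩

/-- An unused colour could be dropped, contradicting the choice of χ(F). Hence no class is empty and
s(F) ≥ 1. -/
theorem optimalColoring_surjective (C : OptimalColoring F) : Function.Surjective C :=
  SimpleGraph.le_chromaticNumber_iff_forall_surjective.mp (coe_toNat_chromaticNumber F).le C

theorem chromaticSurplus_pos (hF : 2 ≤ F.chromaticNumber) : 1 ≤ chromaticSurplus F := by
  obtain ⟨C, i, h⟩ := exists_ncard_colorClass_eq_chromaticSurplus hF
  obtain ⟨x, hx⟩ := optimalColoring_surjective C i
  rw [← h, Nat.one_le_iff_ne_zero]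
  exact Set.ncard_ne_zero_of_mem (a := x) hx

theorem chromaticSurplus_le_card (hF : 2 ≤ F.chromaticNumber) :
    chromaticSurplus F ≤ Fintype.card V := by
  obtain ⟨C, i, h⟩ := exists_ncard_colorClass_eq_chromaticSurplus hF
  rw [← h, ← Nat.card_eq_fintype_card]
  exact Set.ncard_le_card _

omit [Fintype V] in
theorem surplusMinDegree_le {C : OptimalColoring F} {i j : Fin F.chromaticNumber.toNat} {x : V}
    (hi : (C.colorClass i).ncard = chromaticSurplus F) (hij : i ≠ j) (hx : x ∈ C.colorClass i) :
    surplusMinDegree F ≤ (F.neighborSet x ∩ C.colorClass j).ncard :=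
  Nat.sInf_le ⟨C, i, j, x, hi, hij, hx, rfl⟩

/-- Recolouring a vertex of a smallest class shows that it has a neighbour in each other class. -/
theorem surplusMinDegree_mem_Icc (hF : 2 ≤ F.chromaticNumber) :
    1 ≤ surplusMinDegree F ∧ surplusMinDegree F ≤ Fintype.card V := by
  classical
  obtain ⟨C, i, h⟩ := exists_ncard_colorClass_eq_chromaticSurplus hF
  obtain ⟨x, hx⟩ := optimalColoring_surjective C i
  have hq := two_le_toNat_chromaticNumber hF
  -- A second colour makes the set defining τ(F) nonempty, so its infimum is attained and is not the
  -- default 0.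
  have : Nontrivial (Fin F.chromaticNumber.toNat) := Fin.nontrivial_iff_two_le.mpr hq
  obtain ⟨j, hj⟩ := exists_ne i
  obtain ⟨C, i, j, x, h1, h2, h3, h4⟩ := Nat.sInf_mem (s := {d : ℕ | ∃ (C : OptimalColoring F)
    (i j : Fin F.chromaticNumber.toNat) (x : V), (C.colorClass i).ncard = chromaticSurplus F ∧
    i ≠ j ∧ x ∈ C.colorClass i ∧ d = (F.neighborSet x ∩ C.colorClass j).ncard})
    ⟨_, C, i, j, x, h, hj.symm, hx, rfl⟩
  change surplusMinDegree F = _ at h4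
  refine ⟨?_, ?_⟩
  · rw [h4, Nat.one_le_iff_ne_zero]
    intro h0
    rw [Set.ncard_eq_zero] at h0
    have hno : ∀ y, F.Adj x y → C y ≠ j := fun y hy hyj => by
      have : y ∈ F.neighborSet x ∩ C.colorClass j := ⟨hy, hyj⟩
      rw [h0] at this
      exact this
    let C' : OptimalColoring F := SimpleGraph.Coloring.mk (Function.update C x j) (by
      intro a b hab
      by_cases ha : a = x <;> by_cases hb : b = x
      · exact absurd (ha.trans hb.symm) hab.ne
      · subst ha
        rw [Function.update_self, Function.update_of_ne hb]
        exact (hno b hab).symm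
      · subst hb
        rw [Function.update_self, Function.update_of_ne ha]
        exact hno a hab.symm
      · rw [Function.update_of_ne ha, Function.update_of_ne hb]
        exact C.valid hab)
    have hle := chromaticSurplus_le C' i
    have hsub : C'.colorClass i ⊆ C.colorClass i \ {x} := by
      intro y hy
      have hy' : Function.update C x j y = i := hy
      by_cases hyx : y = x
      · rw [hyx, Function.update_self] at hy'
        exact absurd hy'.symm h2
      · rw [Function.update_of_ne hyx] at hy'
        exact ⟨hy', hyx⟩
    have h5 := Set.ncard_le_ncard hsub
    have h6 := Set.ncard_sdiff_singleton_lt_of_mem h3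
    omega
  · rw [h4, ← Nat.card_eq_fintype_card]
    exact Set.ncard_le_card _

/-! ### The extremal colourings. -/

/-- The colouring of a copy of `F` induced by classes of the host graph. -/
def inducedColoring {α : Type} {R : SimpleGraph α} (φ : SimpleGraph.Copy F R) (c : α → ℕ)
    (hc : ∀ x, c x < F.chromaticNumber.toNat) (hR : ∀ x y, R.Adj x y → c x ≠ c y) :
    OptimalColoring F :=
  SimpleGraph.Coloring.mk (fun x => ⟨c (φ x), hc _⟩) fun hab h =>
    hR _ _ (φ.toHom.map_adj hab) (congrArg Fin.val h)

omit [Fintype V] in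
theorem ncard_colorClass_inducedColoring_le {α : Type} [Fintype α] {R : SimpleGraph α}
    (φ : SimpleGraph.Copy F R) (c : α → ℕ)
    (hc : ∀ x, c x < F.chromaticNumber.toNat) (hR : ∀ x y, R.Adj x y → c x ≠ c y)
    (i : Fin F.chromaticNumber.toNat) {T : Finset α} (hT : ∀ x, c x = i → x ∈ T) :
    ((inducedColoring φ c hc hR).colorClass i).ncard ≤ T.card := by
  rw [← Set.ncard_coe_finset]
  exact Set.ncard_le_ncard_of_injOn φ (fun x hx => hT _ (congrArg Fin.val hx)) φ.injective.injOn

/-- The extremal colouring below the Ramsey number. -/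
theorem not_arrows_top (hF : 2 ≤ F.chromaticNumber) {W : Type*} [Fintype W] {H : SimpleGraph W}
    (hH : H.Connected) (hcard : Fintype.card V + 2 ≤ Fintype.card W) {r : ℕ}
    (hr : r < (F.chromaticNumber.toNat - 1) * (Fintype.card W - 1) + chromaticSurplus F) :
    ¬ RamseyArrows (⊤ : SimpleGraph (Fin r)) F H := by
  have hq := two_le_toNat_chromaticNumber hF
  have hs := chromaticSurplus_le_card hF
  have hs1 := chromaticSurplus_pos hF
  set q := F.chromaticNumber.toNat with hqdef
  set n := Fintype.card W with hn
  -- A takes up to q - 1 blocks of at most n - 1 vertices, and fewer than s(F) vertices remain; the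
  -- minimum covers small r.
  obtain ⟨A, hA, hAc⟩ := Finset.exists_subset_card_eq
    (show min r ((q - 1) * (n - 1)) ≤ (Finset.univ : Finset (Fin r)).card by simp)
  obtain ⟨c₀, h1, h2⟩ := exists_balanced_classes (q - 1) (n - 1) A (by omega)
  have hAcompl : Aᶜ.card < chromaticSurplus F := by
    rw [Finset.card_compl, Fintype.card_fin]; omega
  let c : Fin r → ℕ := fun x => if x ∈ A then c₀ x else q - 1
  have hcA : ∀ x ∈ A, c x = c₀ x := fun x hx => if_pos hx
  have hcA' : ∀ x, x ∉ A → c x = q - 1 := fun x hx => if_neg hx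
  have hlast : ∀ x, c x = q - 1 → x ∈ Aᶜ := fun x hx => by
    rw [Finset.mem_compl]
    intro hxA
    have := h1 x hxA
    rw [← hcA x hxA] at this
    omega
  have hc : ∀ x, c x < q := fun x => by
    by_cases hx : x ∈ A
    · have := h1 x hx
      rw [hcA x hx]; omega
    · rw [hcA' x hx]; omega
  let R : SimpleGraph (Fin r) := SimpleGraph.fromRel fun x y => c x ≠ c y
  have hR : ∀ x y, R.Adj x y ↔ c x ≠ c y := fun x y => by
    simp only [R, SimpleGraph.fromRel_adj]
    exact ⟨fun h => h.2.elim id Ne.symm, fun h => ⟨fun hxy => h (by rw [hxy]), Or.inl h⟩⟩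
  intro harr
  rcases harr R le_top with ⟨⟨φ⟩⟩ | hblue
  · have h3 := ncard_colorClass_inducedColoring_le φ c hc (fun x y h => (hR x y).mp h)
      ⟨q - 1, by omega⟩ hlast
    have h4 := chromaticSurplus_le (inducedColoring φ c hc fun x y h => (hR x y).mp h)
      ⟨q - 1, by omega⟩
    omega
  · refine not_isContained_of_small_classes hH (c := c) ?_ ?_ hblue
    · intro x y hxy
      by_contra hne
      exact hxy.2 ((hR x y).mpr hne)
    · intro i
      by_cases hi : i = q - 1
      · refine (Finset.card_le_card (t := Aᶜ) fun x hx => ?_).trans_lt (by omega)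
        exact hlast x ((Finset.mem_filter.mp hx).2.trans hi)
      · refine (Finset.card_le_card fun x hx => ?_).trans_lt ((h2 i).trans_lt (by omega))
        have hxi := (Finset.mem_filter.mp hx).2
        have hxA : x ∈ A := by
          by_contra hxA
          exact hi (by rw [← hxi, hcA' x hxA])
        exact Finset.mem_filter.mpr ⟨hxA, by rw [← hcA x hxA, hxi]⟩

/-- The extremal colouring when `w` misses `n - τ(F)` vertices. -/
theorem not_arrows_of_missing (hF : 2 ≤ F.chromaticNumber) {W : Type*} [Fintype W]
    {H : SimpleGraph W} (hH : H.Connected) (hcard : Fintype.card V + 2 ≤ Fintype.card W) {r : ℕ}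
    (hr : r = (F.chromaticNumber.toNat - 1) * (Fintype.card W - 1) + chromaticSurplus F)
    {G : SimpleGraph (Fin r)} {w : Fin r} {Z : Finset (Fin r)}
    (hZ : ∀ z ∈ Z, z ≠ w ∧ ¬ G.Adj w z)
    (hZc : Fintype.card W ≤ Z.card + surplusMinDegree F) :
    ¬ RamseyArrows G F H := by
  have hq := two_le_toNat_chromaticNumber hF
  have hs := chromaticSurplus_le_card hF
  have hs1 := chromaticSurplus_pos hF
  obtain ⟨hτ1, hτ2⟩ := surplusMinDegree_mem_Icc hF
  set q := F.chromaticNumber.toNat with hqdef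
  set n := Fintype.card W with hn
  set s := chromaticSurplus F with hsdef
  set τ := surplusMinDegree F with hτdef
  have hmul : (q - 1) * (n - 1) = (q - 2) * (n - 1) + (n - 1) := by
    rw [show q - 1 = q - 2 + 1 by omega]; ring
  -- A class A of n - 1 vertices is built around n - τ(F) non-neighbours of w, leaving only τ(F) - 1
  -- possible neighbours of w in it; w goes into the class B of size s(F).
  obtain ⟨Z₀, hZ₀, hZ₀c⟩ := Finset.exists_subset_card_eq (show n - τ ≤ Z.card by omega)
  obtain ⟨A, hZA, hAw, hAc⟩ := Finset.exists_subsuperset_card_eq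
    (show Z₀ ⊆ Finset.univ.erase w from fun z hz =>
      Finset.mem_erase.mpr ⟨(hZ z (hZ₀ hz)).1, Finset.mem_univ z⟩)
    (show Z₀.card ≤ n - 1 by omega)
    (by rw [Finset.card_erase_of_mem (Finset.mem_univ w), Finset.card_univ, Fintype.card_fin]; omega)
  have hwA : w ∉ A := fun h => by simpa using hAw h
  have hAcc : Aᶜ.card = (q - 2) * (n - 1) + s := by
    rw [Finset.card_compl, Fintype.card_fin]; omega
  obtain ⟨B, hwB, hBA, hBc⟩ := Finset.exists_subsuperset_card_eq
    (show {w} ⊆ Aᶜ by simpa using hwA) (show ({w} : Finset (Fin r)).card ≤ s by simpa using hs1)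
    (show s ≤ Aᶜ.card by omega)
  rw [Finset.singleton_subset_iff] at hwB
  obtain ⟨c₀, h1, h2⟩ := exists_balanced_classes (q - 2) (n - 1) (Aᶜ \ B) (by
    rw [Finset.card_sdiff_of_subset hBA]; omega)
  let c : Fin r → ℕ := fun x => if x ∈ B then q - 1 else if x ∈ A then q - 2 else c₀ x
  have cB : ∀ x ∈ B, c x = q - 1 := fun x hx => if_pos hx
  have cA : ∀ x, x ∉ B → x ∈ A → c x = q - 2 := fun x hx hx' => by simp [c, hx, hx']
  have c0 : ∀ x, x ∉ B → x ∉ A → c x = c₀ x ∧ c₀ x < q - 2 := fun x hx hx' =>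
    ⟨by simp [c, hx, hx'], h1 x (by simp [hx, hx'])⟩
  have hlast : ∀ x, c x = q - 1 → x ∈ B := fun x hx => by
    by_contra hxB
    by_cases hxA : x ∈ A
    · have := cA x hxB hxA; omega
    · have := c0 x hxB hxA; omega
  have hlast2 : ∀ x, c x = q - 2 → x ∈ A := fun x hx => by
    by_contra hxA
    by_cases hxB : x ∈ B
    · have := cB x hxB; omega
    · have := c0 x hxB hxA; omega
  have hc : ∀ x, c x < q := fun x => by
    by_cases hxB : x ∈ B
    · have := cB x hxB; omega
    · by_cases hxA : x ∈ A
      · have := cA x hxB hxA; omega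
      · have := c0 x hxB hxA; omega
  let R : SimpleGraph (Fin r) := G ⊓ SimpleGraph.fromRel fun x y => c x ≠ c y
  have hR : ∀ x y, R.Adj x y ↔ G.Adj x y ∧ c x ≠ c y := fun x y => by
    simp only [R, SimpleGraph.inf_adj, SimpleGraph.fromRel_adj]
    exact ⟨fun h => ⟨h.1, h.2.2.elim id Ne.symm⟩, fun h => ⟨h.1, h.1.ne, Or.inl h.2⟩⟩
  have hRc : ∀ x y, R.Adj x y → c x ≠ c y := fun x y h => ((hR x y).mp h).2
  intro harr
  rcases harr R inf_le_left with ⟨⟨φ⟩⟩ | hblue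
  · set C := inducedColoring φ c hc hRc with hC
    let i : Fin q := ⟨q - 1, by omega⟩
    let j : Fin q := ⟨q - 2, by omega⟩
    have h3 : (C.colorClass i).ncard ≤ B.card :=
      ncard_colorClass_inducedColoring_le φ c hc hRc i hlast
    have h4 : s ≤ (C.colorClass i).ncard := chromaticSurplus_le C i
    -- The colour class mapped into B has at least s(F) = |B| vertices, so it fills B and covers w.
    obtain ⟨x, hxC, hxw⟩ : ∃ x ∈ C.colorClass i, φ x = w := by
      have himg : φ '' C.colorClass i = (B : Set (Fin r)) := by
        refine Set.eq_of_subset_of_ncard_le ?_ ?_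
        · rintro _ ⟨x, hx, rfl⟩
          exact hlast _ (congrArg Fin.val hx)
        · have h5 := Set.ncard_image_of_injective (f := (φ : V → Fin r)) (C.colorClass i) φ.injective
          rw [Set.ncard_coe_finset]
          omega
      have : w ∈ φ '' C.colorClass i := by rw [himg]; exact hwB
      exact this
    have h5 : τ ≤ (F.neighborSet x ∩ C.colorClass j).ncard := by
      refine surplusMinDegree_le (by omega) (fun h => ?_) hxC
      have := congrArg Fin.val h
      simp only [i, j] at this
      omega
    have h6 : (F.neighborSet x ∩ C.colorClass j).ncard ≤ (A \ Z₀).card := by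
      rw [← Set.ncard_coe_finset]
      refine Set.ncard_le_ncard_of_injOn φ (fun y hy => ?_) φ.injective.injOn
      refine Finset.mem_coe.mpr (Finset.mem_sdiff.mpr ⟨hlast2 _ (congrArg Fin.val hy.2), ?_⟩)
      intro hyZ
      have hadj : R.Adj (φ x) (φ y) := φ.toHom.map_adj hy.1
      rw [hxw] at hadj
      exact (hZ _ (hZ₀ hyZ)).2 ((hR _ _).mp hadj).1
    rw [Finset.card_sdiff_of_subset hZA] at h6
    omega
  · refine not_isContained_of_small_classes hH (c := c) ?_ ?_ hblue
    · intro x y hxy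
      by_contra hne
      exact hxy.2 ((hR x y).mpr ⟨hxy.1, hne⟩)
    · intro k
      by_cases hk : k = q - 1
      · refine (Finset.card_le_card (t := B) fun x hx => ?_).trans_lt (by omega)
        exact hlast x ((Finset.mem_filter.mp hx).2.trans hk)
      · by_cases hk2 : k = q - 2
        · refine (Finset.card_le_card (t := A) fun x hx => ?_).trans_lt (by omega)
          exact hlast2 x ((Finset.mem_filter.mp hx).2.trans hk2)
        · refine (Finset.card_le_card fun x hx => ?_).trans_lt ((h2 k).trans_lt (by omega))
          have hxk := (Finset.mem_filter.mp hx).2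
          have hxB : x ∉ B := fun h => hk (by rw [← hxk, cB x h])
          have hxA : x ∉ A := fun h => hk2 (by rw [← hxk, cA x hxB h])
          exact Finset.mem_filter.mpr ⟨by simp [hxA, hxB], by rw [← (c0 x hxB hxA).1, hxk]⟩

theorem ncard_colorClass_eq_card_filter {q : ℕ} (C : F.Coloring (Fin q)) (i : Fin q) :
    (C.colorClass i).ncard = (Finset.univ.filter fun x => C x = i).card := by
  rw [← Set.ncard_coe_finset]
  congr 1
  ext x
  simp [SimpleGraph.Coloring.colorClass]

/-! ### Assembling the Ramsey number and the two star-critical bounds. -/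

/-- The dense graphs on `(χ(F) - 1)(n - 1) + s(F)` vertices that arrow. -/
theorem arrows_subdivideEdge {W : Type*} [Fintype W] {H : SimpleGraph W}
    (hF : 2 ≤ F.chromaticNumber) {n κ L ρ : ℕ}
    (hρ : ∀ (α : Type) (R B : SimpleGraph α) (X : Finset α), EdgesCover R B X → ρ ≤ X.card →
      (∃ T ⊆ X, T.card = Fintype.card V ∧ ∀ x ∈ T, ∀ y ∈ T, x ≠ y → R.Adj x y) ∨
      (∃ T ⊆ X, T.card = L ∧ ∀ x ∈ T, ∀ y ∈ T, x ≠ y → B.Adj x y))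
    (hL : Fintype.card W + Fintype.card V * Fintype.card V + Fintype.card V ≤ L)
    (hLn : L ≤ n) (hρn : ρ + 2 ≤ n) {u v : W} (huv : u ≠ v) {c : OptimalColoring F}
    (hc : ∃ i, (c.colorClass i).ncard = chromaticSurplus F)
    (hκ : (Fintype.card V - 2) * (Fintype.card V - largestClass c) + largestClass c + 1 + κ +
      Fintype.card W ≤ n) {r : ℕ}
    (hr : r = (F.chromaticNumber.toNat - 1) * (n - 1) + chromaticSurplus F)
    {G : SimpleGraph (Fin r)} (w : Fin r)
    (hG : ∀ x y, x ≠ w → y ≠ w → x ≠ y → G.Adj x y)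
    (hGw : ∀ Z : Finset (Fin r), (∀ z ∈ Z, z ≠ w ∧ ¬ G.Adj w z) → Z.card ≤ κ) :
    RamseyArrows G F (subdivideEdge H u v (n - Fintype.card W)) := by
  have hq := two_le_toNat_chromaticNumber hF
  have hqV := toNat_chromaticNumber_le_card F
  have : Nontrivial (Fin F.chromaticNumber.toNat) := Fin.nontrivial_iff_two_le.mpr hq
  obtain ⟨i, hi⟩ := hc
  have hle : ∀ j, (c.colorClass j).ncard ≤ largestClass c := fun j =>
    Finset.le_sup (f := fun i => (c.colorClass i).ncard) (Finset.mem_univ j)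
  obtain ⟨j, hij, hj⟩ : ∃ j, i ≠ j ∧ (c.colorClass j).ncard = largestClass c := by
    obtain ⟨j, -, hj⟩ := Finset.exists_mem_eq_sup Finset.univ Finset.univ_nonempty
      (fun i => (c.colorClass i).ncard)
    change largestClass c = _ at hj
    -- If the smallest class is also a largest one, all classes have the same size and any other
    -- class can play the part of j.
    by_cases hij : i = j
    · obtain ⟨j', hj'⟩ := exists_ne i
      refine ⟨j', hj'.symm, le_antisymm (hle j') ?_⟩
      rw [hj, ← hij, hi]
      exact chromaticSurplus_le c j'
    · exact ⟨j, hij, hj.symm⟩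
  intro R hRG
  have hcover : ∀ x y, G.Adj x y → R.Adj x y ∨ (G \ R).Adj x y := fun x y h => by
    by_cases hR : R.Adj x y
    · exact Or.inl hR
    · exact Or.inr ⟨h, hR⟩
  have hoff : EdgesCoverOff R (G \ R) w κ Finset.univ := by
    refine ⟨fun x _ y _ hx hy hxy => hcover x y (hG x y hx hy hxy), fun Z _ hZ => hGw Z ?_⟩
    intro z hz
    obtain ⟨h1, h2, h3⟩ := hZ z hz
    exact ⟨h1, fun h => (hcover w z h).elim h2 h3⟩
  rcases multipartiteCopy_or_subdividedCopy (H := H) huv c hij (by omega)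
    (hρ _ R (G \ R)) hL hLn hρn (fun j => by rw [← ncard_colorClass_eq_card_filter]; exact hle j)
    (by rw [← ncard_colorClass_eq_card_filter]; exact hj) hκ w Finset.univ
    (by rw [← ncard_colorClass_eq_card_filter, hi]; simp [hr]) hoff with h | ⟨g, p, h⟩
  · exact Or.inl (isContained_of_multipartiteCopy c h)
  · exact Or.inr h.isContained

end

theorem starWithEdges_map_adj {r k : ℕ} (f : (Fin 1 ⊕ Fin k) ↪ Fin r) (x y : Fin r) :
    ((starWithEdges k).map f).Adj x y ↔
      (∃ a, x = f (Sum.inl 0) ∧ y = f (Sum.inr a)) ∨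
      (∃ a, y = f (Sum.inl 0) ∧ x = f (Sum.inr a)) := by
  rw [SimpleGraph.map_adj]
  constructor
  · rintro ⟨a | a, b | b, hab, rfl, rfl⟩
    · simp [starWithEdges] at hab
    · exact Or.inl ⟨b, by rw [Subsingleton.elim a 0], rfl⟩
    · exact Or.inr ⟨a, by rw [Subsingleton.elim b 0], rfl⟩
    · simp [starWithEdges] at hab
  · rintro (⟨a, rfl, rfl⟩ | ⟨a, rfl, rfl⟩)
    · exact ⟨Sum.inl 0, Sum.inr a, by simp [starWithEdges], rfl, rfl⟩
    · exact ⟨Sum.inr a, Sum.inl 0, by simp [starWithEdges], rfl, rfl⟩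

theorem theorem1 {V W : Type*} [Fintype V] [Fintype W] (F : SimpleGraph V) (H : SimpleGraph W)
    (hF : 2 ≤ F.chromaticNumber) (hH : H.Connected) :
    ∃ N : ℕ, Fintype.card W ≤ N ∧ ∀ n : ℕ, N ≤ n → ∀ u v : W, H.Adj u v →
      -- the star-critical Ramsey number is `n + C` with `|C| ≤ v(F)² + v(H)`
      (∃ C : ℤ,
        (starCriticalRamsey F (subdivideEdge H u v (n - Fintype.card W)) : ℤ) = n + C ∧
        |C| ≤ (Fintype.card V : ℤ) ^ 2 + Fintype.card W) ∧
      -- explicit lower bound, `t` being the size of the largest class of an optimal colouring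
      -- whose smallest class has size `s(F)`
      (∀ c : OptimalColoring F, (∃ i, (c.colorClass i).ncard = chromaticSurplus F) →
        (n : ℤ) - Fintype.card W
            - ((Fintype.card V : ℤ) - 2) * ((Fintype.card V : ℤ) - largestClass c)
            - largestClass c - 1 ≤
          (starCriticalRamsey F (subdivideEdge H u v (n - Fintype.card W)) : ℤ)) ∧
      -- explicit upper bound
      (starCriticalRamsey F (subdivideEdge H u v (n - Fintype.card W)) : ℤ) ≤
        (n : ℤ) + chromaticSurplus F - surplusMinDegree F - 2 := by
  set m := Fintype.card V with hm
  set L := Fintype.card W + m * m + m with hL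
  obtain ⟨ρ, hρ⟩ := exists_clique_or_clique m L
  refine ⟨L + ρ + m + 4, by omega, fun n hn u v huv => ?_⟩
  have hq := two_le_toNat_chromaticNumber hF
  have hm2 : 2 ≤ m := hq.trans (toNat_chromaticNumber_le_card F)
  have hs := chromaticSurplus_le_card hF
  have hs1 := chromaticSurplus_pos hF
  obtain ⟨hτ1, hτ2⟩ := surplusMinDegree_mem_Icc hF
  set Hn := subdivideEdge H u v (n - Fintype.card W) with hHn
  have hHnc : Hn.Connected := connected_subdivideEdge hH u v _
  have hcardHn : Fintype.card (W ⊕ Fin (n - Fintype.card W)) = n := by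
    rw [Fintype.card_sum, Fintype.card_fin]; omega
  have ht : ∀ c : OptimalColoring F, largestClass c ≤ m := fun c =>
    Finset.sup_le fun i _ => by
      rw [hm, ← Nat.card_eq_fintype_card]; exact Set.ncard_le_card _
  have hloss : ∀ c : OptimalColoring F,
      (m - 2) * (m - largestClass c) + largestClass c ≤ m * m + m := fun c =>
    Nat.add_le_add (Nat.mul_le_mul (Nat.sub_le _ _) (Nat.sub_le _ _)) (ht c)
  set r := (F.chromaticNumber.toNat - 1) * (n - 1) + chromaticSurplus F with hr
  have hrn : n ≤ r := by
    have := Nat.mul_le_mul_right (n - 1) (show 1 ≤ F.chromaticNumber.toNat - 1 by omega)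
    omega
  obtain ⟨c₀, i₀, hc₀⟩ := exists_ncard_colorClass_eq_chromaticSurplus hF
  have hram : ramseyNumber F Hn = r := by
    refine le_antisymm (Nat.sInf_le ?_) (le_csInf ⟨r, ?_⟩ fun r' hr' => ?_)
    rotate_right
    · by_contra hlt
      exact not_arrows_top hF hHnc (by omega) (by rw [hcardHn]; omega) hr'
    -- Arrowing on the complete graph (κ = 0, w arbitrary) gives both the upper bound on the Ramsey
    -- number and the nonemptiness needed for the lower bound.
    all_goals
      exact arrows_subdivideEdge (κ := 0) hF hρ le_rfl (by omega) (by omega) huv.ne ⟨i₀, hc₀⟩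
        (by have := hloss c₀; rw [← hm]; omega) hr ⟨0, by omega⟩ (fun x y _ _ h => h)
        (fun Z hZ => by
          rw [Finset.card_eq_zero.mpr (Finset.eq_empty_of_forall_notMem fun z hz =>
            (hZ z hz).2 (hZ z hz).1.symm)])
  have hstar : starCriticalRamsey F Hn = sSup {k : ℕ | 1 ≤ k ∧ ∃ f : (Fin 1 ⊕ Fin k) ↪ Fin r,
      RamseyArrows ((⊤ : SimpleGraph (Fin r)) \ (starWithEdges k).map f) F Hn} := by
    unfold starCriticalRamsey
    rw [hram]
  have hupper : starCriticalRamsey F Hn ≤ n + chromaticSurplus F - surplusMinDegree F - 2 := by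
    rw [hstar]
    refine csSup_le' ?_
    rintro k ⟨-, f, hf⟩
    -- The construction already excludes k ≥ n - τ(F); since s(F) ≥ 1, the stated bound is no
    -- stronger.
    by_contra hlt
    refine not_arrows_of_missing hF hHnc (by omega) (by rw [hcardHn]) (w := f (Sum.inl 0))
      (Z := Finset.univ.image fun a : Fin k => f (Sum.inr a)) ?_ ?_ hf
    · intro z hz
      obtain ⟨a, -, rfl⟩ := Finset.mem_image.mp hz
      refine ⟨fun h => by simpa using f.injective h, fun h => h.2 ?_⟩
      exact (starWithEdges_map_adj f _ _).mpr (Or.inl ⟨a, rfl, rfl⟩)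
    · have hinj : Function.Injective fun a : Fin k => f (Sum.inr a) :=
        f.injective.comp Sum.inr_injective
      rw [Finset.card_image_of_injective _ hinj, Finset.card_univ, Fintype.card_fin, hcardHn]
      omega
  have hlower : ∀ c : OptimalColoring F, (∃ i, (c.colorClass i).ncard = chromaticSurplus F) →
      n ≤ starCriticalRamsey F Hn + Fintype.card W + (m - 2) * (m - largestClass c) +
        largestClass c + 1 := by
    intro c hc
    have hl := hloss c
    -- κ is the largest number of missing edges that the embedding argument tolerates.
    obtain ⟨κ, hκ⟩ : ∃ κ, (m - 2) * (m - largestClass c) + largestClass c + 1 + κ +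
        Fintype.card W = n :=
      ⟨n - ((m - 2) * (m - largestClass c) + largestClass c + 1 + Fintype.card W), by omega⟩
    have hmem : κ ≤ starCriticalRamsey F Hn := by
      rw [hstar]
      refine le_csSup ⟨r, ?_⟩ ⟨by omega, ?_⟩
      · rintro k ⟨-, f, -⟩
        have := Fintype.card_le_of_embedding f
        simp at this
        omega
      · obtain ⟨f⟩ : Nonempty ((Fin 1 ⊕ Fin κ) ↪ Fin r) :=
          Function.Embedding.nonempty_of_card_le (by simp; omega)
        refine ⟨f, arrows_subdivideEdge hF hρ le_rfl (by omega) (by omega) huv.ne hc hκ.le hr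
          (f (Sum.inl 0)) ?_ ?_⟩
        · intro x y hx hy hxy
          refine ⟨hxy, fun h => ?_⟩
          rcases (starWithEdges_map_adj f x y).mp h with ⟨a, h, -⟩ | ⟨a, h, -⟩
          · exact hx h
          · exact hy h
        · intro Z hZ
          refine (Finset.card_le_card (t := Finset.univ.image fun a : Fin κ => f (Sum.inr a))
            fun z hz => ?_).trans (Finset.card_image_le.trans (by simp))
          obtain ⟨h1, h2⟩ := hZ z hz
          by_contra hcon
          refine h2 ⟨h1.symm, fun h => ?_⟩
          rcases (starWithEdges_map_adj f _ _).mp h with ⟨a, -, h⟩ | ⟨a, h, -⟩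
          · exact hcon (Finset.mem_image.mpr ⟨a, Finset.mem_univ _, h.symm⟩)
          · exact h1 h
    omega
  have hlowerZ : ∀ c : OptimalColoring F, (∃ i, (c.colorClass i).ncard = chromaticSurplus F) →
      (n : ℤ) - Fintype.card W - ((m : ℤ) - 2) * ((m : ℤ) - largestClass c) - largestClass c - 1 ≤
        (starCriticalRamsey F Hn : ℤ) := by
    intro c hc
    have h := hlower c hc
    zify [hm2, ht c] at h
    linarith
  have hupperZ : (starCriticalRamsey F Hn : ℤ) ≤
      (n : ℤ) + chromaticSurplus F - surplusMinDegree F - 2 := by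
    omega
  refine ⟨⟨starCriticalRamsey F Hn - n, by ring, abs_le.mpr ⟨?_, ?_⟩⟩, hlowerZ, hupperZ⟩
  -- The loss (m - 2)(m - t) + t + 1 is linear in t on [0, m], with end values (m - 1)² and m + 1,
  -- both at most m².
  · have h := hlowerZ c₀ ⟨i₀, hc₀⟩
    have h1 : (largestClass c₀ : ℤ) ≤ m := by exact_mod_cast ht c₀
    have h2 : (0 : ℤ) ≤ largestClass c₀ := by positivity
    have h3 : (2 : ℤ) ≤ m := by exact_mod_cast hm2
    nlinarith
  · have h1 : (chromaticSurplus F : ℤ) ≤ m := by exact_mod_cast hs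
    have h3 : (2 : ℤ) ≤ m := by exact_mod_cast hm2
    nlinarith
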